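/- Let $\mathbb{F}$ be a finite field with $q$ elements, $C$ a geometrically irreducible smooth projective curve over $\mathbb{F}$, $\infty$ a closed point of $C$ and $A=\Gamma(C\setminus\{\infty\},\mathcal{O}_C)$; unlabeled tensor products are over $\mathbb{F}$. Let $F$ be a local function field containing $\mathbb{F}$, with valuation ring $\mathcal{O}$, let $F^s$ be a separable closure of $F$ and $I\subset \operatorname{Gal}(F^s|F)$ the inertia group, and let $\kappa:A\to\mathcal{O}$ be a morphism of $\mathbb{F}$-algebras. Let $\tau$ be the endomorphism $a\otimes f\mapsto a\otimes f^q$ of $A\otimes F$ and $\tau^*M=(A\otimes F)\otimes_{\tau}M$. For a sub-$A\otimes\mathcal{O}$-module (or sub-$A\otimes F$-module) $L$ of a finite projective $A\otimes F$-module $M$, let $L[\mathfrak{j}^{-1}]$ be the set of $m\in M\otimes_{A\otimes F}\operatorname{Quot}(A\otimes F)$ for which there is $n\ge 0$ with $(a\otimes 1-1\otimes\kappa(a))^n m\in L$ for all $a\in A\setminus\mathbb{F}$. An $A$-motive over $F$ is a pair $\underline{M}=(M,\tau_M)$ of a locally free $A\otimes F$-module $M$ of finite constant rank and an isomorphism of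 $(A\otimes F)[\mathfrak{j}^{-1}]$-modules $\tau_M:(\tau^*M)[\mathfrak{j}^{-1}]\to M[\mathfrak{j}^{-1}]$; morphisms are the linear maps that commute with $\tau$, exactness is that of the underlying modules, $\mathbb{1}=(A\otimes F,\mathbf{1})$ is the unit $A$-motive, where $\mathbf{1}(s\otimes b)=s\tau(b)$, and $\operatorname{Ext}^1(\mathbb{1},\underline{M})$ is the set of classes of extensions $0\to\underline{M}\to\underline{E}\to\mathbb{1}\to0$. Let $\iota:M[\mathfrak{j}^{-1}]\to\operatorname{Ext}^1(\mathbb{1},\underline{M})$ map $m$ to the class of $\left[M\oplus(A\otimes F),\left(\begin{smallmatrix}\tau_M& m\cdot\mathbf{1}\\0&\mathbf{1}\end{smallmatrix}\right)\right]$. Let $M_{\mathcal{O}}$ be the maximal integral model of $\underline{M}$, that is, the largest finitely generated sub-$A\otimes\mathcal{O}$-module $L$ of $M$ which generates $M$ over $A\otimes F$ and satisfies $\tau_M(\tau^*L)\subset L[\mathfrak{j}^{-1}]$. The integral part $\operatorname{Ext}^1_{\mathcal{O}}(\mathbb{1},\underline{M})$ is $\iota(M_{\mathcal{O}}[\mathfrak{j}^{-1}])$.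 Let $\ell$ be a maximal ideal of $A$ such that $\kappa(\ell)\mathcal{O}=\mathcal{O}$, and let $\mathcal{O}_\ell$ be the completion of $A$ at $\ell$. The $\ell$-adic realization of $\underline{M}$ is the $\mathcal{O}_\ell$-module with Galois action $$T_\ell\underline{M}=\{m\in\varprojlim_n\,(M\otimes_FF^s)/\ell^n(M\otimes_FF^s)\ :\ m=\tau_M(\tau^*m)\},$$ and the good part $\operatorname{Ext}^1_{\mathrm{good}}(\mathbb{1},\underline{M})_\ell$ consists of the classes of the extensions $\underline{E}$ for which the class of $0\to T_\ell\underline{M}\to T_\ell\underline{E}\to T_\ell\mathbb{1}=\mathcal{O}_\ell\to0$ in $H^1(I,T_\ell\underline{M})$ is zero. Theorem. For every $A$-motive $\underline{M}$ over $F$ and every maximal ideal $\ell$ of $A$ such that $\kappa(\ell)\mathcal{O}=\mathcal{O}$, one has $$\operatorname{Ext}^1_{\mathcal{O}}(\mathbb{1},\underline{M})\subset\operatorname{Ext}^1_{\mathrm{good}}(\mathbb{1},\underline{M})_\ell .$$ -/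

import Mathlib

open TensorProduct

set_option linter.unusedSectionVars false

universe u

namespace AndersonMotive

noncomputable section

/-! ### The coefficient ring -/

open AlgebraicGeometry CategoryTheory in
/-- `A` is the `𝔽`-algebra of regular functions on `C ∖ {∞}`, where `C` is a geometrically
irreducible smooth projective curve over `𝔽` and `∞` is a closed point of `C`: there is an open
immersion of `𝔽`-schemes `Spec A ⟶ C` whose image is the complement of the closed point `∞`
(a smooth proper curve over a field is projective, and `C ∖ {∞}` is affine). -/
def IsCurveCoordinateRing (𝔽 A : Type u) [Field 𝔽] [CommRing A] [Algebra 𝔽 A] : Prop :=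
  ∃ (C : Scheme.{u}) (f : C ⟶ Spec (CommRingCat.of 𝔽)) (pt : C) (i : Spec (CommRingCat.of A) ⟶ C),
    IsProper f ∧ SmoothOfRelativeDimension 1 f ∧ GeometricallyIrreducible f ∧
    IsClosed ({pt} : Set C) ∧
    IsOpenImmersion i ∧ Set.range i = {pt}ᶜ ∧
    i ≫ f = Spec.map (CommRingCat.ofHom (algebraMap 𝔽 A))

/-! ### The ring `A ⊗ R`, its Frobenius twist, and poles along `𝔧` -/

section Base

variable {𝔽 A R : Type u} [Field 𝔽] [Fintype 𝔽] [CommRing A] [Algebra 𝔽 A]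
  [CommRing R] [Algebra 𝔽 R]

variable (𝔽 A R) in
/-- The `A`-linear ring endomorphism `τ : a ⊗ r ↦ a ⊗ r ^ q` of `A ⊗ R`, with `q = #𝔽`. -/
def frob : A ⊗[𝔽] R →ₐ[A] A ⊗[𝔽] R :=
  Algebra.TensorProduct.map (AlgHom.id A A) (FiniteField.frobeniusAlgHom 𝔽 R)

/-- The generator `a ⊗ 1 - 1 ⊗ κ(a)` of the ideal `𝔧` of `A ⊗ R`. -/
def jGen (κ : A →ₐ[𝔽] R) (a : A) : A ⊗[𝔽] R := a ⊗ₜ[𝔽] 1 - 1 ⊗ₜ[𝔽] κ a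

/-- The module `M[𝔧⁻¹]`, inside `Quot(A ⊗ R) ⊗ M`: the elements `x` such that, for some `n`, the
multiples `(a ⊗ 1 - 1 ⊗ κ(a)) ^ n • x` with `a ∈ A ∖ 𝔽` all lie in (the image of) `M`. -/
def jInv (κ : A →ₐ[𝔽] R) (M : Type u) [AddCommGroup M] [Module (A ⊗[𝔽] R) M] :
    Submodule (A ⊗[𝔽] R) (FractionRing (A ⊗[𝔽] R) ⊗[A ⊗[𝔽] R] M) where
  carrier := {x | ∃ n : ℕ, ∀ a : A, a ∉ Set.range (algebraMap 𝔽 A) →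
    ∃ y : M, jGen κ a ^ n • x = 1 ⊗ₜ y}
  add_mem' := by
    rintro x x' ⟨n, hn⟩ ⟨n', hn'⟩
    refine ⟨n + n', fun a ha => ?_⟩
    obtain ⟨y, hy⟩ := hn a ha
    obtain ⟨y', hy'⟩ := hn' a ha
    refine ⟨jGen κ a ^ n' • y + jGen κ a ^ n • y', ?_⟩
    rw [smul_add, TensorProduct.tmul_add, TensorProduct.tmul_smul, TensorProduct.tmul_smul,
      ← hy, ← hy', smul_smul, smul_smul, ← pow_add, ← pow_add, add_comm n' n]
  zero_mem' := ⟨0, fun a _ => ⟨0, by simp⟩⟩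
  smul_mem' := by
    rintro c x ⟨n, hn⟩
    refine ⟨n, fun a ha => ?_⟩
    obtain ⟨y, hy⟩ := hn a ha
    exact ⟨c • y, by rw [smul_comm, hy, TensorProduct.tmul_smul]⟩

variable (κ : A →ₐ[𝔽] R)
variable {M N P : Type u} [AddCommGroup M] [Module (A ⊗[𝔽] R) M]
  [AddCommGroup N] [Module (A ⊗[𝔽] R) N] [AddCommGroup P] [Module (A ⊗[𝔽] R) P]

instance : AddCommGroup (jInv κ M) := Submodule.addCommGroup _

instance : Module (A ⊗[𝔽] R) (jInv κ M) := Submodule.module _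

variable (M) in
/-- The canonical map `M → M[𝔧⁻¹]`. -/
def toJInv : M →ₗ[A ⊗[𝔽] R] jInv κ M :=
  LinearMap.codRestrict (jInv κ M) (TensorProduct.mk (A ⊗[𝔽] R) (FractionRing (A ⊗[𝔽] R)) M 1)
    (fun m => ⟨0, fun _ _ => ⟨m, by simp⟩⟩)

/-- Functoriality of `M ↦ M[𝔧⁻¹]`. -/
def jInvMap (f : M →ₗ[A ⊗[𝔽] R] N) : jInv κ M →ₗ[A ⊗[𝔽] R] jInv κ N :=
  LinearMap.restrict (LinearMap.lTensor (FractionRing (A ⊗[𝔽] R)) f) (by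
    rintro x ⟨n, hn⟩
    refine ⟨n, fun a ha => ?_⟩
    obtain ⟨y, hy⟩ := hn a ha
    exact ⟨f y, by rw [← map_smul, hy, LinearMap.lTensor_tmul]⟩)

@[simp] theorem jInvMap_coe (f : M →ₗ[A ⊗[𝔽] R] N) (x : jInv κ M) :
    (jInvMap κ f x : FractionRing (A ⊗[𝔽] R) ⊗[A ⊗[𝔽] R] N) =
      LinearMap.lTensor (FractionRing (A ⊗[𝔽] R)) f x := rfl

theorem jInvMap_id : jInvMap κ (LinearMap.id : M →ₗ[A ⊗[𝔽] R] M) = LinearMap.id := by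
  ext x : 2; simp

theorem jInvMap_comp (g : N →ₗ[A ⊗[𝔽] R] P) (f : M →ₗ[A ⊗[𝔽] R] N) :
    jInvMap κ (g ∘ₗ f) = jInvMap κ g ∘ₗ jInvMap κ f := by
  ext x : 2; simp [LinearMap.lTensor_comp_apply]

/-- `A ⊗ R`, seen as an algebra over itself through `τ`. -/
def TwistedRing (𝔽 A R : Type u) [Field 𝔽] [CommRing A] [Algebra 𝔽 A] [CommRing R] [Algebra 𝔽 R] :
    Type u := A ⊗[𝔽] R

instance : CommRing (TwistedRing 𝔽 A R) := inferInstanceAs (CommRing (A ⊗[𝔽] R))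

instance : Algebra (A ⊗[𝔽] R) (TwistedRing 𝔽 A R) :=
  RingHom.toAlgebra (frob 𝔽 A R : A ⊗[𝔽] R →+* A ⊗[𝔽] R)

/-- The pullback `τ^*M = (A ⊗ R) ⊗_{τ, A ⊗ R} M`. -/
def TauStar (𝔽 A R M : Type u) [Field 𝔽] [Fintype 𝔽] [CommRing A] [Algebra 𝔽 A]
    [CommRing R] [Algebra 𝔽 R] [AddCommGroup M] [Module (A ⊗[𝔽] R) M] : Type u :=
  TwistedRing 𝔽 A R ⊗[A ⊗[𝔽] R] M

instance : AddCommGroup (TauStar 𝔽 A R M) :=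
  inferInstanceAs (AddCommGroup (TwistedRing 𝔽 A R ⊗[A ⊗[𝔽] R] M))

/-- `A ⊗ R` acts on `τ^*M` through the left factor, `b • (a ⊗ m) = (b * a) ⊗ m`. -/
instance : Module (A ⊗[𝔽] R) (TauStar 𝔽 A R M) :=
  inferInstanceAs (Module (TwistedRing 𝔽 A R) (TwistedRing 𝔽 A R ⊗[A ⊗[𝔽] R] M))

/-- The element `s ⊗ m` of `τ^*M`. -/
def TauStar.tmul (s : A ⊗[𝔽] R) (m : M) : TauStar 𝔽 A R M :=
  TensorProduct.tmul (A ⊗[𝔽] R) (M := TwistedRing 𝔽 A R) s m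

theorem TauStar.smul_tmul (b s : A ⊗[𝔽] R) (m : M) :
    b • TauStar.tmul s m = TauStar.tmul (b * s) m := rfl

theorem TauStar.tmul_smul (s b : A ⊗[𝔽] R) (m : M) :
    TauStar.tmul s (b • m) = TauStar.tmul (s * frob 𝔽 A R b) m := by
  have h := TensorProduct.smul_tmul (R := A ⊗[𝔽] R) (R' := A ⊗[𝔽] R) b (id s : TwistedRing 𝔽 A R) m
  rw [Algebra.smul_def, mul_comm] at h
  exact h.symm

variable (M) in
/-- The canonical `τ`-semilinear map `M → τ^*M`, `m ↦ τ^*m = 1 ⊗ m`. -/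
def TauStar.ofModule : M →ₛₗ[(frob 𝔽 A R : A ⊗[𝔽] R →+* A ⊗[𝔽] R)] TauStar 𝔽 A R M where
  toFun m := TauStar.tmul 1 m
  map_add' m m' := TensorProduct.tmul_add _ m m'
  map_smul' b m := by
    rw [TauStar.tmul_smul, one_mul]
    exact (congrArg (fun t => TauStar.tmul t m) (mul_one _)).symm

/-- The map `τ^*f : τ^*M → τ^*N`, `s ⊗ m ↦ s ⊗ f(m)`. -/
def TauStar.map (f : M →ₗ[A ⊗[𝔽] R] N) : TauStar 𝔽 A R M →ₗ[A ⊗[𝔽] R] TauStar 𝔽 A R N :=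
  (TensorProduct.AlgebraTensorModule.lTensor (TwistedRing 𝔽 A R) (TwistedRing 𝔽 A R) f :
    TwistedRing 𝔽 A R ⊗[A ⊗[𝔽] R] M →ₗ[TwistedRing 𝔽 A R] TwistedRing 𝔽 A R ⊗[A ⊗[𝔽] R] N)

/-- An isomorphism `M ≃ N` induces an isomorphism `M[𝔧⁻¹] ≃ N[𝔧⁻¹]`. -/
def jInvCongr (e : M ≃ₗ[A ⊗[𝔽] R] N) : jInv κ M ≃ₗ[A ⊗[𝔽] R] jInv κ N :=
  LinearEquiv.ofLinearMap (jInvMap κ e.toLinearMap) (jInvMap κ e.symm.toLinearMap)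
    (by rw [← jInvMap_comp, LinearEquiv.comp_symm, jInvMap_id])
    (by rw [← jInvMap_comp, LinearEquiv.symm_comp, jInvMap_id])

variable (M N) in
/-- The isomorphism `(M ⊕ N)[𝔧⁻¹] ≃ M[𝔧⁻¹] ⊕ N[𝔧⁻¹]`. -/
def jInvProd : jInv κ (M × N) ≃ₗ[A ⊗[𝔽] R] jInv κ M × jInv κ N :=
  LinearEquiv.ofLinearMap
    ((jInvMap κ (LinearMap.fst _ M N)).prod (jInvMap κ (LinearMap.snd _ M N)))
    ((jInvMap κ (LinearMap.inl _ M N)).coprod (jInvMap κ (LinearMap.inr _ M N)))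
    (by
      refine LinearMap.ext fun x => Prod.ext (Subtype.ext ?_) (Subtype.ext ?_) <;>
      simp [← LinearMap.lTensor_comp_apply])
    (by
      refine LinearMap.ext fun x => Subtype.ext ?_
      change LinearMap.lTensor _ (LinearMap.inl _ M N) (LinearMap.lTensor _ (LinearMap.fst _ M N) x.1) +
        LinearMap.lTensor _ (LinearMap.inr _ M N) (LinearMap.lTensor _ (LinearMap.snd _ M N) x.1) = x.1
      rw [← LinearMap.lTensor_comp_apply, ← LinearMap.lTensor_comp_apply, ← LinearMap.add_apply,
        ← LinearMap.lTensor_add]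
      have h : LinearMap.inl _ M N ∘ₗ LinearMap.fst (A ⊗[𝔽] R) M N +
          LinearMap.inr _ M N ∘ₗ LinearMap.snd (A ⊗[𝔽] R) M N = LinearMap.id := by
        refine LinearMap.ext fun y => ?_
        simp
      rw [h, LinearMap.lTensor_id_apply])

theorem jInvProd_jInvMap_inl (x : jInv κ M) :
    jInvProd κ M N (jInvMap κ (LinearMap.inl _ M N) x) = (x, 0) := by
  refine Prod.ext (Subtype.ext ?_) (Subtype.ext ?_)
  · change LinearMap.lTensor _ (LinearMap.fst _ M N)
      (LinearMap.lTensor _ (LinearMap.inl _ M N) x.1) = x.1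
    rw [← LinearMap.lTensor_comp_apply, LinearMap.fst_comp_inl, LinearMap.lTensor_id_apply]
  · change LinearMap.lTensor _ (LinearMap.snd _ M N)
      (LinearMap.lTensor _ (LinearMap.inl _ M N) x.1) = 0
    rw [← LinearMap.lTensor_comp_apply, LinearMap.snd_comp_inl, LinearMap.lTensor_zero,
      LinearMap.zero_apply]

theorem jInvMap_snd_jInvProd_symm (z : jInv κ M × jInv κ N) :
    jInvMap κ (LinearMap.snd _ M N) ((jInvProd κ M N).symm z) = z.2 :=
  congrArg Prod.snd ((jInvProd κ M N).apply_symm_apply z)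

theorem jInvProd_symm_inl (x : jInv κ M) :
    (jInvProd κ M N).symm (x, 0) = jInvMap κ (LinearMap.inl _ M N) x := by
  rw [LinearEquiv.symm_apply_eq, jInvProd_jInvMap_inl]

/-- For `m ∈ M[𝔧⁻¹]`, the map `(A ⊗ R)[𝔧⁻¹] → M[𝔧⁻¹]`, `c ↦ c • m`. -/
def jInvSMul (m : jInv κ M) : jInv κ (A ⊗[𝔽] R) →ₗ[A ⊗[𝔽] R] jInv κ M :=
  LinearMap.restrict
    (((LinearMap.toSpanSingleton (FractionRing (A ⊗[𝔽] R))
        (FractionRing (A ⊗[𝔽] R) ⊗[A ⊗[𝔽] R] M) m).restrictScalars (A ⊗[𝔽] R)) ∘ₗ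
      (TensorProduct.rid (A ⊗[𝔽] R) (FractionRing (A ⊗[𝔽] R))).toLinearMap) (by
    obtain ⟨m, n', hn'⟩ := m
    rintro x ⟨n, hn⟩
    refine ⟨n + n', fun a ha => ?_⟩
    obtain ⟨y, hy⟩ := hn a ha
    obtain ⟨z, hz⟩ := hn' a ha
    refine ⟨y • z, ?_⟩
    rw [pow_add, mul_comm, mul_smul, ← map_smul, hy]
    simp only [LinearMap.comp_apply, LinearEquiv.coe_coe, TensorProduct.rid_tmul,
      LinearMap.coe_restrictScalars, LinearMap.toSpanSingleton_apply]
    rw [smul_assoc, one_smul, smul_comm, hz, TensorProduct.tmul_smul])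

variable (𝔽 A R M N) in
/-- The isomorphism `τ^*(M ⊕ N) ≃ τ^*M ⊕ τ^*N`. -/
def TauStar.prod :
    TauStar 𝔽 A R (M × N) ≃ₗ[A ⊗[𝔽] R] TauStar 𝔽 A R M × TauStar 𝔽 A R N :=
  (TensorProduct.prodRight (A ⊗[𝔽] R) (TwistedRing 𝔽 A R) (TwistedRing 𝔽 A R) M N :
    TwistedRing 𝔽 A R ⊗[A ⊗[𝔽] R] (M × N) ≃ₗ[TwistedRing 𝔽 A R]
      (TwistedRing 𝔽 A R ⊗[A ⊗[𝔽] R] M) × (TwistedRing 𝔽 A R ⊗[A ⊗[𝔽] R] N))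

variable (𝔽 A R) in
/-- The isomorphism `𝟏 : τ^*(A ⊗ R) ≃ A ⊗ R`, `s ⊗ b ↦ s * τ(b)`. -/
def TauStar.unit : TauStar 𝔽 A R (A ⊗[𝔽] R) ≃ₗ[A ⊗[𝔽] R] A ⊗[𝔽] R :=
  (TensorProduct.AlgebraTensorModule.rid (A ⊗[𝔽] R) (TwistedRing 𝔽 A R) (TwistedRing 𝔽 A R) :
    TwistedRing 𝔽 A R ⊗[A ⊗[𝔽] R] (A ⊗[𝔽] R) ≃ₗ[TwistedRing 𝔽 A R] TwistedRing 𝔽 A R)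

theorem TauStar.map_id : TauStar.map (LinearMap.id : M →ₗ[A ⊗[𝔽] R] M) = LinearMap.id :=
  LinearMap.ext fun x => LinearMap.lTensor_id_apply (TwistedRing 𝔽 A R) M x

theorem TauStar.map_comp (g : N →ₗ[A ⊗[𝔽] R] P) (f : M →ₗ[A ⊗[𝔽] R] N) :
    TauStar.map (g ∘ₗ f) = TauStar.map g ∘ₗ TauStar.map f :=
  LinearMap.ext fun x => LinearMap.lTensor_comp_apply (TwistedRing 𝔽 A R) g f x

theorem TauStar.prod_comp_inl :
    (TauStar.prod 𝔽 A R M N).toLinearMap ∘ₗ TauStar.map (LinearMap.inl _ M N) =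
      LinearMap.inl _ _ _ := by
  refine LinearMap.ext fun x => ?_
  induction x using TensorProduct.induction_on with
  | zero => exact map_zero _
  | tmul s m => exact Prod.ext rfl (TensorProduct.tmul_zero _ _)
  | add x y hx hy => exact (map_add _ x y).trans ((congrArg₂ _ hx hy).trans (map_add _ x y).symm)

theorem TauStar.snd_comp_prod :
    LinearMap.snd _ _ _ ∘ₗ (TauStar.prod 𝔽 A R M N).toLinearMap =
      TauStar.map (LinearMap.snd _ M N) := by
  refine LinearMap.ext fun x => ?_
  induction x using TensorProduct.induction_on with
  | zero => exact map_zero _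
  | tmul s m => rfl
  | add x y hx hy => exact (map_add _ x y).trans ((congrArg₂ _ hx hy).trans (map_add _ x y).symm)

end Base

/-- The automorphism `(x, y) ↦ (x + f(y), y)` of `M ⊕ N`. -/
def shear {S M N : Type*} [CommRing S] [AddCommGroup M] [Module S M] [AddCommGroup N] [Module S N]
    (f : N →ₗ[S] M) : (M × N) ≃ₗ[S] M × N where
  toFun x := (x.1 + f x.2, x.2)
  map_add' x y := by ext <;> simp [add_add_add_comm]
  map_smul' c x := by ext <;> simp
  invFun x := (x.1 - f x.2, x.2)
  left_inv x := by simp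
  right_inv x := by simp

/-! ### `A`-motives, their morphisms and extensions -/

section Motives

variable {𝔽 A R : Type u} [Field 𝔽] [Fintype 𝔽] [CommRing A] [Algebra 𝔽 A]
  [CommRing R] [Algebra 𝔽 R]

/-- An (Anderson) `A`-motive over `R`, with characteristic morphism `κ : A → R`: a locally free
`A ⊗ R`-module `M` of finite constant rank with an isomorphism `τ_M : (τ^*M)[𝔧⁻¹] → M[𝔧⁻¹]`
(which is automatically `(A ⊗ R)[𝔧⁻¹]`-linear). -/
structure AMotive (κ : A →ₐ[𝔽] R) where
  /-- the underlying module -/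
  carrier : Type u
  [addCommGroup : AddCommGroup carrier]
  [module : Module (A ⊗[𝔽] R) carrier]
  [finite : Module.Finite (A ⊗[𝔽] R) carrier]
  [projective : Module.Projective (A ⊗[𝔽] R) carrier]
  constantRank : ∃ r : ℕ, ∀ p : PrimeSpectrum (A ⊗[𝔽] R), Module.rankAtStalk carrier p = r
  /-- the isomorphism `τ_M` -/
  tau : jInv κ (TauStar 𝔽 A R carrier) ≃ₗ[A ⊗[𝔽] R] jInv κ carrier

attribute [instance] AMotive.addCommGroup AMotive.module AMotive.finite AMotive.projective

variable {κ : A →ₐ[𝔽] R}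

/-- The `τ`-semilinear map `M → M[𝔧⁻¹]`, `m ↦ τ_M(τ^*m)`. -/
def AMotive.phi (M : AMotive κ) :
    M.carrier →ₛₗ[(frob 𝔽 A R : A ⊗[𝔽] R →+* A ⊗[𝔽] R)] jInv κ M.carrier :=
  (M.tau.toLinearMap ∘ₗ toJInv κ (TauStar 𝔽 A R M.carrier)).comp (TauStar.ofModule M.carrier)

/-- The unit `A`-motive `𝟙 = (A ⊗ R, 𝟏)`. -/
def AMotive.unit (κ : A →ₐ[𝔽] R) : AMotive κ where
  carrier := A ⊗[𝔽] R
  constantRank := ⟨1, fun p => by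
    have : Nontrivial (A ⊗[𝔽] R) := ⟨0, 1, fun h => p.2.ne_top ((Ideal.eq_top_iff_one _).2
      (h ▸ p.asIdeal.zero_mem))⟩
    simp⟩
  tau := jInvCongr κ (TauStar.unit 𝔽 A R)

/-- A linear map commutes with `τ`: `f ∘ τ_M = τ_N ∘ τ^*f`. -/
def AMotive.Commutes (M N : AMotive κ) (f : M.carrier →ₗ[A ⊗[𝔽] R] N.carrier) : Prop :=
  ∀ x : jInv κ (TauStar 𝔽 A R M.carrier),
    jInvMap κ f (M.tau x) = N.tau (jInvMap κ (TauStar.map f) x)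

/-- Morphisms of `A`-motives. -/
structure AMotive.Hom (M N : AMotive κ) where
  /-- the underlying linear map -/
  toLinearMap : M.carrier →ₗ[A ⊗[𝔽] R] N.carrier
  commutes : M.Commutes N toLinearMap

/-- An extension of `𝟙` by `M`: a short exact sequence `0 → M → E → 𝟙 → 0` of `A`-motives. -/
structure Extension (M : AMotive κ) where
  /-- the middle term `E` -/
  obj : AMotive κ
  /-- the morphism `M → E` -/
  inj : M.Hom obj
  /-- the morphism `E → 𝟙` -/
  proj : obj.Hom (AMotive.unit κ)
  injective : Function.Injective inj.toLinearMap
  exact : Function.Exact inj.toLinearMap proj.toLinearMap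
  surjective : Function.Surjective proj.toLinearMap

/-- Two extensions of `𝟙` by `M` are equivalent if there is an isomorphism of `A`-motives between
their middle terms that is compatible with the identities of `M` and `𝟙`. -/
def Extension.Equivalent {M : AMotive κ} (E E' : Extension M) : Prop :=
  ∃ f : E.obj.carrier ≃ₗ[A ⊗[𝔽] R] E'.obj.carrier, E.obj.Commutes E'.obj f.toLinearMap ∧
    (∀ x, f (E.inj.toLinearMap x) = E'.inj.toLinearMap x) ∧
    ∀ y, E'.proj.toLinearMap (f y) = E.proj.toLinearMap y

theorem AMotive.Commutes.id (M : AMotive κ) : M.Commutes M LinearMap.id := by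
  intro x
  rw [TauStar.map_id, jInvMap_id, jInvMap_id]
  rfl

theorem AMotive.Commutes.comp {M N P : AMotive κ} {g : N.carrier →ₗ[A ⊗[𝔽] R] P.carrier}
    {f : M.carrier →ₗ[A ⊗[𝔽] R] N.carrier} (hg : N.Commutes P g) (hf : M.Commutes N f) :
    M.Commutes P (g ∘ₗ f) := by
  intro x
  rw [TauStar.map_comp, jInvMap_comp, jInvMap_comp, LinearMap.comp_apply, hf, hg]
  rfl

theorem AMotive.Commutes.symm {M N : AMotive κ} {f : M.carrier ≃ₗ[A ⊗[𝔽] R] N.carrier}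
    (hf : M.Commutes N f.toLinearMap) : N.Commutes M f.symm.toLinearMap := by
  intro x
  have h1 : ∀ y, jInvMap κ f.symm.toLinearMap (jInvMap κ f.toLinearMap y) = y := fun y => by
    rw [← LinearMap.comp_apply, ← jInvMap_comp, LinearEquiv.symm_comp, jInvMap_id]
    rfl
  have h2 : jInvMap κ (TauStar.map f.toLinearMap)
      (jInvMap κ (TauStar.map f.symm.toLinearMap) x) = x := by
    rw [← LinearMap.comp_apply, ← jInvMap_comp, ← TauStar.map_comp, LinearEquiv.comp_symm,
      TauStar.map_id, jInvMap_id]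
    rfl
  rw [← h1 (M.tau _), hf, h2]

instance Extension.setoid (M : AMotive κ) : Setoid (Extension M) where
  r := Extension.Equivalent
  iseqv :=
    { refl := fun E => ⟨LinearEquiv.refl _ _, AMotive.Commutes.id _, fun _ => rfl, fun _ => rfl⟩
      symm := by
        rintro E E' ⟨f, hf, h1, h2⟩
        exact ⟨f.symm, hf.symm, fun x => by rw [← h1, LinearEquiv.symm_apply_apply],
          fun y => by rw [← h2, LinearEquiv.apply_symm_apply]⟩
      trans := by
        rintro E E' E'' ⟨f, hf, h1, h2⟩ ⟨g, hg, h3, h4⟩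
        exact ⟨f.trans g, AMotive.Commutes.comp hg hf, fun x => by simp [h1, h3],
          fun y => by simp [h2, h4]⟩ }

/-- The (Yoneda) extension group `Ext¹(𝟙, M)` in the exact category of `A`-motives over `R`:
equivalence classes of extensions of `𝟙` by `M`. -/
def Ext1 (M : AMotive κ) : Type (u + 1) := Quotient (Extension.setoid M)

/-- The `A`-motive `M ⊕ (A ⊗ R)` with `τ = (τ_M, m · 𝟏; 0, 𝟏)`. -/
def AMotive.twist (M : AMotive κ) (m : jInv κ M.carrier) : AMotive κ where
  carrier := M.carrier × (A ⊗[𝔽] R)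
  constantRank := by
    obtain ⟨r, hr⟩ := M.constantRank
    refine ⟨r + 1, fun p => ?_⟩
    have : Nontrivial (A ⊗[𝔽] R) := ⟨0, 1, fun h => p.2.ne_top ((Ideal.eq_top_iff_one _).2
      (h ▸ p.asIdeal.zero_mem))⟩
    rw [Module.rankAtStalk_prod, Pi.add_apply, hr]
    simp
  tau := jInvCongr κ (TauStar.prod 𝔽 A R M.carrier (A ⊗[𝔽] R)) ≪≫ₗ
    jInvProd κ (TauStar 𝔽 A R M.carrier) (TauStar 𝔽 A R (A ⊗[𝔽] R)) ≪≫ₗ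
    LinearEquiv.prodCongr M.tau (jInvCongr κ (TauStar.unit 𝔽 A R)) ≪≫ₗ shear (jInvSMul κ m) ≪≫ₗ
    (jInvProd κ M.carrier (A ⊗[𝔽] R)).symm

theorem AMotive.commutes_inl (M : AMotive κ) (m : jInv κ M.carrier) :
    M.Commutes (M.twist m) (LinearMap.inl _ M.carrier (A ⊗[𝔽] R)) := by
  intro x
  have h1 : jInvProd κ (TauStar 𝔽 A R M.carrier) (TauStar 𝔽 A R (A ⊗[𝔽] R))
      (jInvMap κ (TauStar.prod 𝔽 A R M.carrier (A ⊗[𝔽] R)).toLinearMap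
        (jInvMap κ (TauStar.map (LinearMap.inl _ M.carrier (A ⊗[𝔽] R))) x)) = (x, 0) := by
    rw [← LinearMap.comp_apply, ← jInvMap_comp, TauStar.prod_comp_inl, jInvProd_jInvMap_inl]
  have h2 : shear (jInvSMul κ m)
      (LinearEquiv.prodCongr M.tau (jInvCongr κ (TauStar.unit 𝔽 A R)) (x, 0)) = (M.tau x, 0) := by
    refine Prod.ext ?_ ?_
    · change M.tau x + jInvSMul κ m (jInvCongr κ (TauStar.unit 𝔽 A R) 0) = M.tau x
      rw [map_zero, map_zero, add_zero]
    · exact map_zero (jInvCongr κ (TauStar.unit 𝔽 A R))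
  refine (jInvProd_symm_inl κ _).symm.trans
    (congrArg (jInvProd κ M.carrier (A ⊗[𝔽] R)).symm (h2.symm.trans ?_))
  exact congrArg (fun z => shear (jInvSMul κ m)
    (LinearEquiv.prodCongr M.tau (jInvCongr κ (TauStar.unit 𝔽 A R)) z)) h1.symm

theorem AMotive.commutes_snd (M : AMotive κ) (m : jInv κ M.carrier) :
    (M.twist m).Commutes (AMotive.unit κ) (LinearMap.snd _ M.carrier (A ⊗[𝔽] R)) := by
  intro x
  refine (jInvMap_snd_jInvProd_symm κ _).trans ?_
  change (AMotive.unit κ).tau ((jInvMap κ (LinearMap.snd _ _ _) ∘ₗ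
    jInvMap κ (TauStar.prod 𝔽 A R M.carrier (A ⊗[𝔽] R)).toLinearMap) x) = _
  rw [← jInvMap_comp, TauStar.snd_comp_prod]
  rfl

/-- The extension `0 → M → [M ⊕ (A ⊗ R), (τ_M, m · 𝟏; 0, 𝟏)] → 𝟙 → 0`. -/
def Extension.ofElement (M : AMotive κ) (m : jInv κ M.carrier) : Extension M where
  obj := M.twist m
  inj := ⟨LinearMap.inl _ M.carrier (A ⊗[𝔽] R), M.commutes_inl m⟩
  proj := ⟨LinearMap.snd _ M.carrier (A ⊗[𝔽] R), M.commutes_snd m⟩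
  injective := LinearMap.inl_injective
  exact := fun y => ⟨fun h => ⟨y.1, Prod.ext rfl h.symm⟩, by rintro ⟨x, rfl⟩; rfl⟩
  surjective := fun y => ⟨(0, y), rfl⟩

/-- The map `ι : M[𝔧⁻¹] → Ext¹(𝟙, M)`. -/
def iota (M : AMotive κ) (m : jInv κ M.carrier) : Ext1 M := ⟦Extension.ofElement M m⟧

end Motives

/-! ### Extension of scalars -/

section ExtendScalars

variable {𝔽 A R S : Type u} [Field 𝔽] [CommRing A] [Algebra 𝔽 A]
  [CommRing R] [Algebra 𝔽 R] [CommRing S] [Algebra 𝔽 S] [Algebra R S] [IsScalarTower 𝔽 R S]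

variable (𝔽 A R S) in
/-- The ring homomorphism `A ⊗ R → A ⊗ S`, `a ⊗ r ↦ a ⊗ r`. -/
def extendRing : A ⊗[𝔽] R →ₐ[A] A ⊗[𝔽] S :=
  Algebra.TensorProduct.map (AlgHom.id A A) (IsScalarTower.toAlgHom 𝔽 R S)

instance (priority := low) extendAlgebra : Algebra (A ⊗[𝔽] R) (A ⊗[𝔽] S) :=
  RingHom.toAlgebra (extendRing 𝔽 A R S : A ⊗[𝔽] R →+* A ⊗[𝔽] S)

instance (priority := low) extendScalarTower :
    IsScalarTower A (A ⊗[𝔽] R) (A ⊗[𝔽] S) :=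
  IsScalarTower.of_algebraMap_eq' (extendRing 𝔽 A R S).comp_algebraMap.symm

end ExtendScalars

/-! ### Integral models and the integral part of `Ext¹(𝟙, M)` -/

section Models

variable {𝔽 A R S : Type u} [Field 𝔽] [Fintype 𝔽] [CommRing A] [Algebra 𝔽 A]
  [CommRing R] [Algebra 𝔽 R] [CommRing S] [Algebra 𝔽 S] [Algebra R S] [IsScalarTower 𝔽 R S]

/-- An `A ⊗ S`-module is an `A ⊗ R`-module. -/
instance (priority := low) AMotive.restrictModule {κ : A →ₐ[𝔽] S} (M : AMotive κ) :
    Module (A ⊗[𝔽] R) M.carrier :=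
  Module.compHom M.carrier (algebraMap (A ⊗[𝔽] R) (A ⊗[𝔽] S))

/-- The submodule `L[𝔧⁻¹]` of `M[𝔧⁻¹]`, for a sub-`A ⊗ R`-module `L` of `M`. -/
def subJInv {κ : A →ₐ[𝔽] S} {M : AMotive κ} (L : Submodule (A ⊗[𝔽] R) M.carrier) :
    Set (jInv κ M.carrier) :=
  {x | ∃ n : ℕ, ∀ a : A, a ∉ Set.range (algebraMap 𝔽 A) →
    ∃ y ∈ L, jGen κ a ^ n • x = toJInv κ M.carrier y}

/-- `L` is an `R`-integral model of the `A`-motive `M` over `S`: a sub-`A ⊗ R`-module of `M` of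
finite type that generates `M` over `A ⊗ S` and satisfies `τ_M(τ^*L) ⊆ L[𝔧⁻¹]`. -/
structure IsIntegralModel {κ : A →ₐ[𝔽] S} (M : AMotive κ)
    (L : Submodule (A ⊗[𝔽] R) M.carrier) : Prop where
  fg : L.FG
  span_eq_top : Submodule.span (A ⊗[𝔽] S) (L : Set M.carrier) = ⊤
  stable : ∀ m ∈ L, M.phi m ∈ subJInv L

variable (R) in
/-- The maximal `R`-integral model `M_R` of `M`: the sum of all the integral models, which is the
greatest integral model as soon as there is a maximal one
(see `IsIntegralModel.eq_maximalModel`). -/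
def maximalModel {κ : A →ₐ[𝔽] S} (M : AMotive κ) : Submodule (A ⊗[𝔽] R) M.carrier :=
  sSup {L | IsIntegralModel M L}

variable {κ : A →ₐ[𝔽] S} {M : AMotive κ}

theorem subJInv_mono {L L' : Submodule (A ⊗[𝔽] R) M.carrier} (h : L ≤ L') :
    subJInv L ⊆ subJInv L' := by
  rintro x ⟨n, hn⟩
  refine ⟨n, fun a ha => ?_⟩
  obtain ⟨y, hy, e⟩ := hn a ha
  exact ⟨y, h hy, e⟩

theorem IsIntegralModel.sup {κ : A →ₐ[𝔽] R}
    {M : AMotive ((IsScalarTower.toAlgHom 𝔽 R S).comp κ)}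
    {L L' : Submodule (A ⊗[𝔽] R) M.carrier}
    (h : IsIntegralModel M L) (h' : IsIntegralModel M L') : IsIntegralModel M (L ⊔ L') where
  fg := h.fg.sup h'.fg
  span_eq_top := top_le_iff.1 (h.span_eq_top.ge.trans
    (Submodule.span_mono (SetLike.coe_subset_coe.2 le_sup_left)))
  stable := by
    intro m hm
    obtain ⟨l, hl, l', hl', rfl⟩ := Submodule.mem_sup.1 hm
    obtain ⟨n, hn⟩ := h.stable l hl
    obtain ⟨n', hn'⟩ := h'.stable l' hl'
    refine ⟨n + n', fun a ha => ?_⟩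
    obtain ⟨y, hy, e⟩ := hn a ha
    obtain ⟨y', hy', e'⟩ := hn' a ha
    have hj : ∀ (k : ℕ) (z : M.carrier),
        jGen ((IsScalarTower.toAlgHom 𝔽 R S).comp κ) a ^ k • z = jGen κ a ^ k • z := by
      intro k z
      have : jGen ((IsScalarTower.toAlgHom 𝔽 R S).comp κ) a =
          algebraMap (A ⊗[𝔽] R) (A ⊗[𝔽] S) (jGen κ a) := by
        change _ = extendRing 𝔽 A R S (jGen κ a)
        simp [jGen, extendRing]
      rw [this, ← map_pow]
      rfl
    refine ⟨jGen κ a ^ n' • y + jGen κ a ^ n • y', Submodule.add_mem_sup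
      (L.smul_mem _ hy) (L'.smul_mem _ hy'), ?_⟩
    rw [← hj, ← hj, map_add, map_add, map_smul, map_smul, smul_add, ← e, ← e', smul_smul,
      smul_smul, ← pow_add, ← pow_add, add_comm n' n]

/-- A maximal integral model contains every integral model, and is equal to `maximalModel`. -/
theorem IsIntegralModel.eq_maximalModel {κ : A →ₐ[𝔽] R}
    {M : AMotive ((IsScalarTower.toAlgHom 𝔽 R S).comp κ)}
    {L : Submodule (A ⊗[𝔽] R) M.carrier} (h : Maximal (IsIntegralModel M) L) :
    maximalModel R M = L :=
  le_antisymm (sSup_le fun _ h' => le_sup_right.trans (h.2 (h.1.sup h') le_sup_left))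
    (le_sSup h.1)

variable (R) in
/-- The integral part `Ext¹_R(𝟙, M)` of `Ext¹(𝟙, M)`: the image of `M_R[𝔧⁻¹]` under `ι`. -/
def integralPart {κ : A →ₐ[𝔽] S} (M : AMotive κ) : Set (Ext1 M) :=
  iota M '' subJInv (maximalModel R M)

end Models

/-! ### The `ℓ`-adic realization and good reduction -/

section Realization

variable {𝔽 A F L : Type u} [Field 𝔽] [Fintype 𝔽] [CommRing A] [Algebra 𝔽 A]
  [Field F] [Algebra 𝔽 F] [Field L] [Algebra 𝔽 L] [Algebra F L] [IsScalarTower 𝔽 F L]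

variable (𝔽 A F L) in
/-- The base change `X_L = (A ⊗ L) ⊗_{A ⊗ F} X = X ⊗_F L` of an `A ⊗ F`-module `X`. -/
abbrev BaseChange (X : Type u) [AddCommGroup X] [Module (A ⊗[𝔽] F) X] : Type u :=
  (A ⊗[𝔽] L) ⊗[A ⊗[𝔽] F] X

theorem map_galois_extendRing (σ : L ≃ₐ[F] L) (s : A ⊗[𝔽] F) :
    Algebra.TensorProduct.map (AlgHom.id A A) (σ.restrictScalars 𝔽 : L →ₐ[𝔽] L)
      (extendRing 𝔽 A F L s) = extendRing 𝔽 A F L s := by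
  induction s using TensorProduct.induction_on with
  | zero => simp
  | tmul a x => simp [extendRing]
  | add x y hx hy => rw [map_add, map_add, hx, hy]

theorem frob_extendRing (s : A ⊗[𝔽] F) :
    frob 𝔽 A L (extendRing 𝔽 A F L s) = extendRing 𝔽 A F L (frob 𝔽 A F s) := by
  induction s using TensorProduct.induction_on with
  | zero => simp
  | tmul a x => simp [extendRing, frob]
  | add x y hx hy => simp only [map_add, hx, hy]

variable (L) in
/-- The base change `f_L : X_L → Y_L` of a linear map `f`. -/
def baseChangeMap {X Y : Type u} [AddCommGroup X] [Module (A ⊗[𝔽] F) X]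
    [AddCommGroup Y] [Module (A ⊗[𝔽] F) Y] (f : X →ₗ[A ⊗[𝔽] F] Y) :
    BaseChange 𝔽 A F L X →ₗ[A] BaseChange 𝔽 A F L Y :=
  (LinearMap.lTensor (A ⊗[𝔽] L) f).restrictScalars A

/-- The action of an automorphism `σ` of `L` over `F` on `X_L = X ⊗_F L`, through the right
factor. -/
def galoisMap (σ : L ≃ₐ[F] L) (X : Type u) [AddCommGroup X] [Module (A ⊗[𝔽] F) X] :
    BaseChange 𝔽 A F L X →ₗ[A] BaseChange 𝔽 A F L X :=
  (LinearMap.rTensor X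
    ({ toFun := Algebra.TensorProduct.map (AlgHom.id A A) (σ.restrictScalars 𝔽 : L →ₐ[𝔽] L)
       map_add' := map_add _
       map_smul' := fun s y => by
        rw [Algebra.smul_def, map_mul, RingHom.id_apply, Algebra.smul_def]
        exact congrArg (· * _) (map_galois_extendRing σ s) } : A ⊗[𝔽] L →ₗ[A ⊗[𝔽] F] A ⊗[𝔽] L)).restrictScalars A

variable (𝔽 A F L) in
/-- The endomorphism `τ` of `A ⊗ L`, as a semilinear map over the endomorphism `τ` of `A ⊗ F`. -/
def frobSemilinear :
    A ⊗[𝔽] L →ₛₗ[(frob 𝔽 A F : A ⊗[𝔽] F →+* A ⊗[𝔽] F)] A ⊗[𝔽] L where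
  toFun := frob 𝔽 A L
  map_add' := map_add _
  map_smul' s y := by
    rw [Algebra.smul_def, map_mul, Algebra.smul_def]
    exact congrArg (· * _) (frob_extendRing s)

variable {κ : A →ₐ[𝔽] F}

variable (L) in
/-- The base change `M_L → M[𝔧⁻¹]_L`, `m ⊗ x ↦ τ_M(τ^*m) ⊗ x ^ q`, of `m ↦ τ_M(τ^*m)`. -/
def AMotive.phiBaseChange (M : AMotive κ) :
    BaseChange 𝔽 A F L M.carrier →ₗ[A] BaseChange 𝔽 A F L (jInv κ M.carrier) where
  toFun := TensorProduct.map (frobSemilinear 𝔽 A F L) M.phi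
  map_add' := map_add _
  map_smul' a x := by
    induction x using TensorProduct.induction_on with
    | zero => simp
    | tmul y m =>
      rw [TensorProduct.smul_tmul', TensorProduct.map_tmul, TensorProduct.map_tmul, RingHom.id_apply,
        TensorProduct.smul_tmul']
      exact congrArg (· ⊗ₜ _) (map_smul (frob 𝔽 A L) a y)
    | add x y hx hy => rw [smul_add, map_add, hx, hy, map_add, smul_add]

variable (L) in
/-- The `ℓ`-adic completion `lim_n M_L / ℓ ^ n M_L`. -/
abbrev AMotive.Completion (M : AMotive κ) (ℓ : Ideal A) : Type u :=
  AdicCompletion ℓ (BaseChange 𝔽 A F L M.carrier)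

variable (L) in
/-- The `ℓ`-adic realization `T_ℓ M = {m ∈ lim_n M_L / ℓ ^ n M_L | m = τ_M(τ^*m)}`, for `L` a
separable closure of `F`. The equality is read in `lim_n M[𝔧⁻¹]_L / ℓ ^ n M[𝔧⁻¹]_L`, which is
`lim_n M_L / ℓ ^ n M_L` if `𝔧` and `ℓ` are coprime. -/
def AMotive.tateModule (M : AMotive κ) (ℓ : Ideal A) :
    Submodule (AdicCompletion ℓ A) (M.Completion L ℓ) :=
  LinearMap.eqLocus (AdicCompletion.map ℓ (baseChangeMap L (toJInv κ M.carrier)))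
    (AdicCompletion.map ℓ (M.phiBaseChange L))

/-- The action of an automorphism `σ` of `L` over `F` on `lim_n M_L / ℓ ^ n M_L`. -/
def AMotive.galois (M : AMotive κ) (ℓ : Ideal A) (σ : L ≃ₐ[F] L) :
    M.Completion L ℓ →ₗ[AdicCompletion ℓ A] M.Completion L ℓ :=
  AdicCompletion.map ℓ (galoisMap σ M.carrier)

variable (L) in
/-- The map on completions induced by a morphism of `A`-motives. -/
def AMotive.Hom.completion {M N : AMotive κ} (f : M.Hom N) (ℓ : Ideal A) :
    M.Completion L ℓ →ₗ[AdicCompletion ℓ A] N.Completion L ℓ :=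
  AdicCompletion.map ℓ (baseChangeMap L f.toLinearMap)

variable (L) in
/-- The element `1` of `T_ℓ 𝟙 = 𝒪_ℓ`. -/
def tateOne (κ : A →ₐ[𝔽] F) (ℓ : Ideal A) : (AMotive.unit κ).Completion L ℓ :=
  AdicCompletion.of ℓ _ ((1 : A ⊗[𝔽] L) ⊗ₜ[A ⊗[𝔽] F] (1 : A ⊗[𝔽] F))

/-- Let `I` be a set of automorphisms of `L` over `F`. The class in `H¹(I, T_ℓ M)` of the extension
`0 → T_ℓ M → T_ℓ E → T_ℓ 𝟙 = 𝒪_ℓ → 0` vanishes: if `e ∈ T_ℓ E` is a lift of `1`, the class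
is that of the cocycle `σ ↦ σ e - e`, and this is the coboundary `σ ↦ σ t - t` of some
`t ∈ T_ℓ M`. Equivalently, the extension splits as an extension of representations of `I`. -/
def Extension.SplitsOn {M : AMotive κ} (E : Extension M) (ℓ : Ideal A) (I : Set (L ≃ₐ[F] L)) :
    Prop :=
  ∃ e ∈ E.obj.tateModule L ℓ, E.proj.completion L ℓ e = tateOne L κ ℓ ∧
    ∃ t ∈ M.tateModule L ℓ, ∀ σ ∈ I,
      E.obj.galois ℓ σ e - e = E.inj.completion L ℓ (M.galois ℓ σ t - t)

end Realization

section Inertia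

variable (O F L : Type u) [CommRing O] [IsLocalRing O] [Field F] [Algebra O F] [Field L]
  [Algebra F L] [Algebra O L] [IsScalarTower O F L]

/-- The inertia group of `L` over `F`, where `O` is a henselian (e.g. complete) valuation ring of
`F`: the automorphisms that act trivially on the residue field of the integral closure of `O` in
`L`. The maximal ideal of that integral closure is the radical of the ideal generated by the
maximal ideal of `O`. -/
def inertiaGroup : Subgroup (L ≃ₐ[F] L) where
  carrier := {σ | ∀ x : integralClosure O L, (σ.restrictScalars O).mapIntegralClosure x - x ∈
    ((IsLocalRing.maximalIdeal O).map (algebraMap O (integralClosure O L))).radical}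
  mul_mem' := by
    intro σ τ hσ hτ x
    have := Ideal.add_mem _ (hσ ((τ.restrictScalars O).mapIntegralClosure x)) (hτ x)
    rw [sub_add_sub_cancel] at this
    exact this
  one_mem' := by
    intro x
    have : ((1 : L ≃ₐ[F] L).restrictScalars O).mapIntegralClosure x = x := rfl
    rw [this, sub_self]
    exact Ideal.zero_mem _
  inv_mem' := by
    intro σ hσ x
    have := hσ ((σ⁻¹.restrictScalars O).mapIntegralClosure x)
    have h : (σ.restrictScalars O).mapIntegralClosure
        ((σ⁻¹.restrictScalars O).mapIntegralClosure x) = x :=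
      Subtype.ext (σ.apply_symm_apply x)
    rw [h, ← neg_mem_iff, neg_sub] at this
    exact this

end Inertia

section Good

variable {𝔽 A O F : Type u} [Field 𝔽] [Fintype 𝔽] [CommRing A] [Algebra 𝔽 A]
  [CommRing O] [IsLocalRing O] [Field F] [Algebra 𝔽 F] [Algebra O F]

/-- The good `ℓ`-adic part `Ext¹_good(𝟙, M)_ℓ` of `Ext¹(𝟙, M)`, that is, the kernel of the
`ℓ`-adic realization `Ext¹(𝟙, M) → H¹(I, T_ℓ M)`, where `I` is the inertia group of a separable
closure `Fs` of `F` and `O` is the valuation ring of `F`. (The condition does not depend on the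
extension that represents the class; all representatives are required to satisfy it.) -/
def goodPart (O Fs : Type u) [CommRing O] [IsLocalRing O] [Algebra O F] [Field Fs] [Algebra 𝔽 Fs]
    [Algebra F Fs] [IsScalarTower 𝔽 F Fs] [Algebra O Fs] [IsScalarTower O F Fs]
    {κ : A →ₐ[𝔽] F} (M : AMotive κ) (ℓ : Ideal A) : Set (Ext1 M) :=
  {c | ∀ E : Extension M, (⟦E⟧ : Quotient (Extension.setoid M)) = c →
    E.SplitsOn ℓ (inertiaGroup O F Fs : Set (Fs ≃ₐ[F] Fs))}

end Good

end

end AndersonMotive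

/-!
The class of `ι(m)` is trivial on the inertia group `I` as soon as the equation
`ξ = τ_M(τ^*ξ) + m` has a solution `ξ` in the `ℓ`-adic completion of `M ⊗ F^s` that is fixed by `I`:
the extension has a section `s` of `1` with `τ_E(τ^*s) = s + m`
(`Extension.exists_section_of_mk_eq_iota`), so that `ξ + s` is an `I`-invariant lift of `1` to
`T_ℓ E` (`Extension.splitsOn_of_approximate_solutions`). The integrality of `m` provides such
a solution with coefficients in the ring `U` of integers of the maximal unramified extension of `F`.

In terms of generators of an integral model, and after multiplication by a power `z` of
`j = a ⊗ 1 - 1 ⊗ κ(a)`, the equation is `z w - T τ(w) = μ` for vectors over `A ⊗ U`. Here `a ∈ ℓ`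
is chosen with `κ(a)` a unit, so that `j` is invertible modulo every power of `ℓ` and multiplication
by `z` loses nothing. The operator `w ↦ z w - T τ(w)` is `A`-linear; therefore its surjectivity
modulo `ℓ` suffices, by successive approximation (`exists_approximate_solutions`). As `A / ℓ` is
finite over `𝔽`, surjectivity modulo `ℓ` says that the systems `x = B x^{(q)} + b` over `U` are
solvable (`exists_frobenius_system_solution`).

Such a system is reduced to one variable: `b` satisfies a linear relation with its iterates under
`x ↦ B x^{(q)}`, by noetherianity, and elimination leads to an equation `y = p(y)` with `p' = 0`.
This has a solution in `U` (`exists_unramifiedIntegers_eval_eq_self`): the logarithmic derivative of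
`X - p` at `0` shows that one of its roots is integral, since the integral closure of `O` in `F^s` is
a valuation ring (`isIntegral_or_isIntegral_inv`); and a root of `X - p` is determined by its residue
class, hence fixed by `I`.
-/

namespace AndersonMotive

/-! ### Integral elements over a complete discrete valuation ring -/

section Valuation

open Polynomial

theorem isIntegral_inv_of_isUnit_coeff_zero {R K : Type*} [CommRing R] [Nontrivial R] [Field K]
    [Algebra R K] {q : R[X]} {x : K} (hq : IsUnit (q.coeff 0)) (hx : aeval x q = 0) :
    IsIntegral R x⁻¹ := by
  rcases eq_or_ne x 0 with rfl | hx0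
  · rw [inv_zero]
    exact isIntegral_zero
  have hlc : q.reverse.leadingCoeff = q.coeff 0 := by
    rw [reverse_leadingCoeff, trailingCoeff,
      natTrailingDegree_eq_zero.2 (Or.inr hq.ne_zero)]
  obtain ⟨u, hu⟩ := hq
  refine ⟨C (↑u⁻¹ : R) * q.reverse,
    monic_C_mul_of_mul_leadingCoeff_eq_one (by rw [hlc, ← hu, Units.inv_mul]), ?_⟩
  have := invertibleOfNonzero hx0
  have hrev := (eval₂_reverse_eq_zero_iff (algebraMap R K) x q).2 hx
  rw [eval₂_mul, ← invOf_eq_inv, hrev, mul_zero]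

/-- Over a complete discrete valuation ring, an algebraic element or its inverse is integral:
Weierstrass preparation splits a primitive polynomial into a monic factor and a factor with
invertible constant coefficient. -/
theorem isIntegral_or_isIntegral_inv {O K : Type*} [CommRing O] [IsDomain O]
    [IsDiscreteValuationRing O] [IsAdicComplete (IsLocalRing.maximalIdeal O) O]
    [Field K] [Algebra O K] [FaithfulSMul O K] {x : K} (hx : IsAlgebraic O x) :
    IsIntegral O x ∨ IsIntegral O x⁻¹ := by
  classical
  let _ : NormalizedGCDMonoid O := Nonempty.some inferInstance
  obtain ⟨f, hf0, hfx⟩ := hx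
  have hPx : aeval x f.primPart = 0 := aeval_primPart_eq_zero hf0 hfx
  set P := f.primPart with hP
  have hprim : P.IsPrimitive := isPrimitive_primPart f
  obtain ⟨ϖ, hϖ⟩ := IsDiscreteValuationRing.exists_irreducible O
  have hPne : (P : PowerSeries O).map (IsLocalRing.residue O) ≠ 0 := by
    intro h
    refine hϖ.not_isUnit (hprim ϖ ((C_dvd_iff_dvd_coeff _ _).2 fun i => ?_))
    have hi := congrArg (PowerSeries.coeff i) h
    rw [PowerSeries.coeff_map, coeff_coe, map_zero, IsLocalRing.residue_eq_zero_iff,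
      hϖ.maximalIdeal_eq, Ideal.mem_span_singleton] at hi
    exact hi
  obtain ⟨g, h, H⟩ := PowerSeries.exists_isWeierstrassFactorization hPne
  have hg := H.isDistinguishedAt.monic
  have hdiv := modByMonic_add_div P g
  have hr : (g : PowerSeries O) * (h - (P /ₘ g : O[X])) = (P %ₘ g : O[X]) := by
    rw [mul_sub, ← H.eq_mul, ← coe_mul, sub_eq_iff_eq_add, ← coe_add, hdiv]
  have hord : g.natDegree = ((g : PowerSeries O).map (IsLocalRing.residue O)).order.toNat := by
    have h1 := H.isDistinguishedAt.coe_natDegree_eq_order_map (g : PowerSeries O) 1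
      (by rw [map_one, ← Ideal.ne_top_iff_one]; exact Ideal.IsPrime.ne_top') (by simp)
    exact congr(ENat.toNat $h1)
  have hz := (H.isDistinguishedAt.isWeierstrassDivisorAt Ideal.IsPrime.ne_top').eq_zero_of_mul_eq
    (lt_of_lt_of_eq (degree_modByMonic_lt P hg)
      ((degree_eq_natDegree hg.ne_zero).trans (congrArg (Nat.cast (R := WithBot ℕ)) hord))) hr
  have hPg : P = g * (P /ₘ g) := by
    rw [hz.2, zero_add] at hdiv
    exact hdiv.symm
  have hq : IsUnit ((P /ₘ g).coeff 0) := by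
    have := H.isUnit
    rw [sub_eq_zero.1 hz.1, PowerSeries.isUnit_iff_constantCoeff] at this
    simpa using this
  rw [hPg, map_mul, mul_eq_zero] at hPx
  exact hPx.imp (fun h1 => ⟨g, hg, h1⟩) (isIntegral_inv_of_isUnit_coeff_zero hq)

/-- A polynomial `p` with vanishing derivative and coefficients in a valuation ring `V` of a
separably closed field has a fixed point in `V`. If all the roots `z` of the separable polynomial
`X - p` were outside `V`, its logarithmic derivative at `0`, which is `-∑ z⁻¹`, would contradict
the integrality of `p(0)`. -/
theorem exists_eval_eq_self_of_derivative_eq_zero {K : Type*} [Field K] [IsSepClosed K]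
    (V : ValuationSubring K) (p : K[X]) (hp : p.coeff 0 ∈ V) (hd : derivative p = 0) :
    ∃ y ∈ V, p.eval y = y := by
  have hd' : derivative (X - p) = 1 := by rw [derivative_sub, derivative_X, hd, sub_zero]
  have hsep : (X - p).Separable := by
    rw [separable_def, hd']
    exact isCoprime_one_right
  have hs := IsSepClosed.splits_of_separable _ hsep
  have hne : X - p ≠ 0 := hsep.ne_zero
  by_contra! hcon
  have hroot : ∀ z ∈ (X - p).roots, 1 < V.valuation z := by
    intro z hz
    rw [mem_roots hne, IsRoot, eval_sub, eval_X, sub_eq_zero] at hz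
    by_contra! hle
    exact hcon z ((V.valuation_le_one_iff z).1 hle) hz.symm
  have h0 : eval 0 (X - p) ≠ 0 := by
    intro h0
    rw [eval_sub, eval_X, sub_eq_zero] at h0
    exact hcon 0 V.zero_mem h0.symm
  have key := hs.eval_derivative_eq_eval_mul_sum h0
  rw [hd', eval_one] at key
  have hsum : ∀ s : Multiset K, (∀ z ∈ s, 1 < V.valuation z) →
      V.valuation (s.map fun z ↦ 1 / (0 - z)).sum < 1 := by
    intro s
    induction s using Multiset.induction_on with
    | empty => simp
    | cons a s ih =>
      intro h
      rw [Multiset.map_cons, Multiset.sum_cons]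
      refine Valuation.map_add_lt _ ?_ (ih fun z hz => h z (Multiset.mem_cons_of_mem hz))
      have ha := h a (Multiset.mem_cons_self a s)
      rw [zero_sub, one_div, map_inv₀, Valuation.map_neg]
      exact inv_lt_one_of_one_lt₀ ha
  have h1 : V.valuation (eval 0 (X - p)) ≤ 1 := by
    rw [eval_sub, eval_X, zero_sub, Valuation.map_neg, ← coeff_zero_eq_eval_zero,
      V.valuation_le_one_iff]
    exact hp
  have := congrArg V.valuation key
  rw [map_one, map_mul] at this
  exact ((mul_le_of_le_one_left' h1).trans_lt (hsum _ hroot)).ne this.symm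

end Valuation

/-! ### The ring of integers of the maximal unramified extension -/

section Inertia

open Polynomial

variable (O F L : Type u) [CommRing O] [IsLocalRing O] [Field F] [Algebra O F] [Field L]
  [Algebra F L] [Algebra O L] [IsScalarTower O F L]

/-- The integral elements of `L` that are fixed by the inertia group. When `L` is a separable
closure of `F`, this is the ring of integers of the maximal unramified extension of `F`. -/
def unramifiedIntegers : Subalgebra O L where
  carrier := {x | IsIntegral O x ∧ ∀ σ ∈ inertiaGroup O F L, σ x = x}
  mul_mem' hx hy := ⟨hx.1.mul hy.1, fun σ hσ => by rw [map_mul, hx.2 σ hσ, hy.2 σ hσ]⟩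
  add_mem' hx hy := ⟨hx.1.add hy.1, fun σ hσ => by rw [map_add, hx.2 σ hσ, hy.2 σ hσ]⟩
  algebraMap_mem' r := ⟨isIntegral_algebraMap, fun σ _ => by
    rw [IsScalarTower.algebraMap_apply O F L, AlgEquiv.commutes]⟩

instance : Algebra.IsIntegral O (unramifiedIntegers O F L) :=
  ⟨fun x => (isIntegral_algHom_iff (unramifiedIntegers O F L).val Subtype.val_injective).1 x.2.1⟩

variable {O F L}

/-- An element of the inertia group moves a root `x` of `X - p`, with `p' = 0`, by a root `d` of
an equation `d = k d²`; as `d` is in every maximal ideal, it vanishes. -/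
theorem apply_eq_self_of_eval_eq_self [FaithfulSMul O L] {p : L[X]}
    (hp : ∀ i, p.coeff i ∈ unramifiedIntegers O F L) (hd : derivative p = 0) {x : L}
    (hx : IsIntegral O x) (hpx : p.eval x = x) {σ : L ≃ₐ[F] L} (hσ : σ ∈ inertiaGroup O F L) :
    σ x = x := by
  obtain ⟨P, rfl⟩ : p ∈ lifts (algebraMap (integralClosure O L) L) :=
    (lifts_iff_coeff_lifts _).2 fun i => ⟨⟨p.coeff i, (hp i).1⟩, rfl⟩
  let x' : integralClosure O L := ⟨x, hx⟩
  let y' : integralClosure O L := (σ.restrictScalars O).mapIntegralClosure x'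
  have hinj : Function.Injective (algebraMap (integralClosure O L) L) := Subtype.val_injective
  have hP : derivative P = 0 := map_injective _ hinj (by
    rw [← derivative_map, Polynomial.map_zero]; exact hd)
  have hσP : (P.map (algebraMap (integralClosure O L) L)).map (σ : L →+* L) =
      P.map (algebraMap (integralClosure O L) L) := by
    ext i
    rw [coeff_map]
    exact (hp i).2 σ hσ
  have h1 : P.eval x' = x' := hinj (by rw [← eval_map_apply]; exact hpx)
  have h2 : P.eval y' = y' := hinj (by
    rw [← eval_map_apply, ← hσP]
    change eval ((σ : L →+* L) x) _ = σ x
    rw [eval_map_apply]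
    exact congrArg σ hpx)
  have hmem := hσ x'
  change y' - x' ∈ _ at hmem
  set d := y' - x' with hdd
  obtain ⟨k, hk⟩ := P.binomExpansion x' d
  have hkd : d * (1 - k * d) = 0 := by
    rw [hP, eval_zero, zero_mul, add_zero, hdd, add_sub_cancel, h1, h2, ← hdd] at hk
    linear_combination (hdd + hk)
  have hd0 : d = 0 := by
    refine (mul_eq_zero.1 hkd).resolve_right fun h => ?_
    have htop := Ideal.eq_top_of_isUnit_mem _ hmem (IsUnit.of_mul_eq_one k (by linear_combination -h))
    rw [Ideal.radical_eq_top] at htop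
    have hker : Function.Injective (algebraMap O (integralClosure O L)) := fun a b hab =>
      FaithfulSMul.algebraMap_injective O L (congrArg Subtype.val hab)
    obtain ⟨Q, hQ, hQm⟩ := Ideal.exists_ideal_over_maximal_of_isIntegral
      (S := integralClosure O L) (IsLocalRing.maximalIdeal O)
      (by rw [(RingHom.injective_iff_ker_eq_bot _).1 hker]; exact bot_le)
    exact hQ.ne_top (top_le_iff.1 (htop.ge.trans (Ideal.map_le_iff_le_comap.2 hQm.ge)))
  exact congrArg Subtype.val (sub_eq_zero.1 hd0)

end Inertia

section UnramifiedIntegers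

open Polynomial

variable (O F L : Type u) [CommRing O] [IsDomain O] [IsDiscreteValuationRing O]
  [IsAdicComplete (IsLocalRing.maximalIdeal O) O] [Field F] [Algebra O F] [IsFractionRing O F]
  [Field L] [Algebra F L] [Algebra O L] [IsScalarTower O F L]

/-- The integral closure of a complete discrete valuation ring in an algebraic extension of its
fraction field, as a valuation ring. -/
def integralValuationSubring [Algebra.IsAlgebraic F L] : ValuationSubring L where
  __ := (integralClosure O L).toSubring
  mem_or_inv_mem' x := by
    have : FaithfulSMul O F := IsFractionRing.instFaithfulSMul O F
    have : FaithfulSMul O L := FaithfulSMul.trans O F L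
    exact isIntegral_or_isIntegral_inv
      ((IsFractionRing.isAlgebraic_iff O F L).2 (Algebra.IsAlgebraic.isAlgebraic x))

/-- A polynomial `p` with zero derivative has a fixed point in the ring of integers of the maximal
unramified extension: a form of Hensel's lemma for `X - p`, whose derivative is `1`. -/
theorem exists_unramifiedIntegers_eval_eq_self [IsSepClosure F L]
    (p : (unramifiedIntegers O F L)[X]) (hd : derivative p = 0) : ∃ y, p.eval y = y := by
  have : FaithfulSMul O F := IsFractionRing.instFaithfulSMul O F
  have : FaithfulSMul O L := FaithfulSMul.trans O F L
  have : IsSepClosed L := IsSepClosure.sep_closed F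
  have : Algebra.IsSeparable F L := IsSepClosure.separable
  have hinj : Function.Injective (algebraMap (unramifiedIntegers O F L) L) := Subtype.val_injective
  set P := p.map (algebraMap (unramifiedIntegers O F L) L) with hP
  have hPc : ∀ i, P.coeff i ∈ unramifiedIntegers O F L := fun i => by
    rw [hP, coeff_map]
    exact (p.coeff i).2
  have hPd : derivative P = 0 := by rw [hP, derivative_map, hd, Polynomial.map_zero]
  obtain ⟨y, hy, hPy⟩ := exists_eval_eq_self_of_derivative_eq_zero
    (integralValuationSubring O F L) P (hPc 0).1 hPd
  refine ⟨⟨y, hy, fun σ hσ => apply_eq_self_of_eval_eq_self hPc hPd hy hPy hσ⟩, hinj ?_⟩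
  rw [← eval_map_apply]
  exact hPy

end UnramifiedIntegers

/-! ### Frobenius-linear systems -/

section FrobeniusSystems

open Polynomial

variable (𝔽 : Type*) {U : Type*} [Field 𝔽] [Fintype 𝔽] [CommRing U] [Algebra 𝔽 U]

/-- The polynomials obtained by elimination from the linear relation
`Φ^s b = ∑ c_i Φ^i b`: `p₀ = 1 + c₀ X ^ q`, `p_{i + 1} = p_i ^ q + c_{i + 1} X ^ q`. -/
noncomputable def eliminant (q : ℕ) (c : ℕ → U) : ℕ → U[X]
  | 0 => 1 + C (c 0) * X ^ q
  | i + 1 => eliminant q c i ^ q + C (c (i + 1)) * X ^ q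

theorem derivative_eliminant (c : ℕ → U) (i : ℕ) :
    derivative (eliminant (Fintype.card 𝔽) c i) = 0 := by
  have hq : ((Fintype.card 𝔽 : ℕ) : U[X]) = 0 := by
    rw [← map_natCast (algebraMap 𝔽 U[X]), FiniteField.cast_card_eq_zero, map_zero]
  cases i <;> simp [eliminant, derivative_pow, hq]

/-- If the iterates of `b` under a `q`-semilinear map `Φ` satisfy a linear relation, the equation
`x - Φ x = b` has a solution `x = ∑ y_i Φ^i b`: the coefficients `y_i` are determined by the last
one, which is a fixed point of a polynomial with zero derivative. -/
theorem exists_sub_apply_eq_of_iterate_eq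
    (hU : ∀ p : U[X], derivative p = 0 → ∃ y, p.eval y = y)
    {N : Type*} [AddCommGroup N] [Module U N] (Φ : N →+ N)
    (hΦ : ∀ (a : U) x, Φ (a • x) = a ^ Fintype.card 𝔽 • Φ x) (b : N) (s : ℕ) (c : ℕ → U)
    (hb : Φ^[s] b = ∑ i ∈ Finset.range s, c i • Φ^[i] b) : ∃ x, x - Φ x = b := by
  rcases s with - | t
  · exact ⟨0, by simpa using hb.symm⟩
  set q := Fintype.card 𝔽
  obtain ⟨y, hy⟩ := hU _ (derivative_eliminant 𝔽 c t)
  set Y : ℕ → U := fun i => (eliminant q c i).eval y with hY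
  have hY0 : Y 0 = 1 + c 0 * y ^ q := by simp [hY, eliminant]
  have hYs : ∀ i, Y (i + 1) = Y i ^ q + c (i + 1) * y ^ q := fun i => by simp [hY, eliminant]
  have hYt : Y t = y := hy
  refine ⟨∑ i ∈ Finset.range (t + 1), Y i • Φ^[i] b, ?_⟩
  have h1 : Φ (∑ i ∈ Finset.range (t + 1), Y i • Φ^[i] b) =
      ∑ i ∈ Finset.range t, Y i ^ q • Φ^[i + 1] b +
        ∑ i ∈ Finset.range (t + 1), (c i * y ^ q) • Φ^[i] b := by
    rw [map_sum, Finset.sum_range_succ]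
    congr 1
    · exact Finset.sum_congr rfl fun i _ => by rw [hΦ, Function.iterate_succ_apply']
    · rw [hΦ, ← Function.iterate_succ_apply' (f := Φ), hb, hYt, Finset.smul_sum]
      exact Finset.sum_congr rfl fun i _ => by rw [smul_smul, mul_comm]
  rw [h1, Finset.sum_range_succ', Finset.sum_range_succ' (fun i => (c i * y ^ q) • Φ^[i] b), hY0]
  simp only [hYs, add_smul, one_smul, Finset.sum_add_distrib, Function.iterate_zero, id_eq]
  abel

/-- In an algebra `U` that is integral over a noetherian ring and in which every polynomial with
zero derivative has a fixed point, all the systems `x = B x^{(q)} + b` are solvable. -/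
theorem exists_frobenius_system_solution (O : Type*) [CommRing O] [IsNoetherianRing O]
    [Algebra O U] [Algebra.IsIntegral O U]
    (hU : ∀ p : U[X], derivative p = 0 → ∃ y, p.eval y = y)
    {ι : Type*} [Fintype ι] (B : ι → ι → U) (b : ι → U) :
    ∃ x : ι → U, ∀ i, x i = ∑ j, B i j * x j ^ Fintype.card 𝔽 + b i := by
  set q := Fintype.card 𝔽 with hq
  let Φ : (ι → U) →+ (ι → U) :=
    { toFun := fun x i => ∑ j, B i j * x j ^ q
      map_zero' := by ext i; simp [hq, Fintype.card_ne_zero]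
      map_add' := fun x y => by
        ext i
        have : ∀ j, (x j + y j) ^ q = x j ^ q + y j ^ q := fun j =>
          map_add (FiniteField.frobeniusAlgHom 𝔽 U) (x j) (y j)
        simp only [Pi.add_apply, this, mul_add, Finset.sum_add_distrib] }
  have hΦ : ∀ (a : U) x, Φ (a • x) = a ^ q • Φ x := fun a x => by
    ext i
    change ∑ j, B i j * (a * x j) ^ q = a ^ q * ∑ j, B i j * x j ^ q
    rw [Finset.mul_sum]
    exact Finset.sum_congr rfl fun j _ => by ring
  -- The relation between the iterates of `b` is found over the noetherian subalgebra `U'`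
  -- generated by the coefficients of the system.
  let S : Set U := Set.range (fun p : ι × ι => B p.1 p.2) ∪ Set.range b
  let U' := Algebra.adjoin O S
  have hfin : Module.Finite O U' :=
    ⟨(Submodule.fg_top _).2 (fg_adjoin_of_finite ((Set.finite_range _).union (Set.finite_range _))
      fun x _ => Algebra.IsIntegral.isIntegral x)⟩
  have hnoeth : IsNoetherianRing U' := isNoetherian_of_tower O inferInstance
  let B' : ι → ι → U' := fun i j => ⟨B i j, Algebra.subset_adjoin (Or.inl ⟨(i, j), rfl⟩)⟩
  let b' : ι → U' := fun i => ⟨b i, Algebra.subset_adjoin (Or.inr ⟨i, rfl⟩)⟩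
  let Φ' : (ι → U') → (ι → U') := fun x i => ∑ j, B' i j * x j ^ q
  let coe : (ι → U') → (ι → U) := fun x i => x i
  have hcoe : Function.Semiconj coe Φ' Φ := fun x => by
    ext i
    change ((∑ j, B' i j * x j ^ q : U') : U) = ∑ j, B i j * (x j : U) ^ q
    push_cast
    rfl
  let W : ℕ →o Submodule U' (ι → U') :=
    ⟨fun n => Submodule.span U' ((fun i => Φ'^[i] b') '' (Finset.range n : Set ℕ)), fun m n h =>
      Submodule.span_mono (Set.image_mono (by simpa using h))⟩
  obtain ⟨s, hs⟩ := monotone_stabilizes_iff_noetherian.2 (inferInstance : IsNoetherian U' (ι → U')) W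
  have hmem : Φ'^[s] b' ∈ W s := by
    rw [hs (s + 1) s.le_succ]
    exact Submodule.subset_span ⟨s, by simp, rfl⟩
  obtain ⟨c, hc⟩ := Submodule.mem_span_image_finset_iff_exists_fun U' |>.1 hmem
  obtain ⟨c', hc'⟩ : ∃ c' : ℕ → U', ∀ i : Finset.range s, c' i = c i :=
    ⟨Function.extend Subtype.val c 0, fun i => Subtype.val_injective.extend_apply c 0 i⟩
  simp only [← hc'] at hc
  rw [Finset.sum_coe_sort _ fun i => c' i • Φ'^[i] b'] at hc
  obtain ⟨x, hx⟩ := exists_sub_apply_eq_of_iterate_eq 𝔽 hU Φ hΦ b s (fun i => (c' i : U)) (by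
    have h := congrArg coe hc
    rw [(hcoe.iterate_right s).eq] at h
    refine Eq.trans h.symm ?_
    ext k
    simp only [coe, Finset.sum_apply, Pi.smul_apply, smul_eq_mul]
    push_cast
    refine Finset.sum_congr rfl fun i _ => ?_
    rw [show ((Φ'^[i] b' k : U') : U) = coe (Φ'^[i] b') k from rfl, (hcoe.iterate_right i).eq])
  refine ⟨x, fun i => ?_⟩
  have := congrFun hx i
  rw [Pi.sub_apply, sub_eq_iff_eq_add] at this
  rw [this, add_comm]
  rfl

end FrobeniusSystems

/-! ### Frobenius-linear operators modulo powers of a maximal ideal -/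

section Residue

open Polynomial

variable {𝔽 A U : Type u} [Field 𝔽] [Fintype 𝔽] [CommRing A] [Algebra 𝔽 A]
  [CommRing U] [Algebra 𝔽 U]

theorem exists_sub_sum_tmul_mem_map (ℓ : Ideal A) {K : Type*} [Fintype K] (e : K → A)
    (he : ∀ a, ∃ f : K → 𝔽, a - ∑ k, f k • e k ∈ ℓ) (x : A ⊗[𝔽] U) :
    ∃ y : K → U, x - ∑ k, e k ⊗ₜ[𝔽] y k ∈ ℓ.map (algebraMap A (A ⊗[𝔽] U)) := by
  induction x using TensorProduct.induction_on with
  | zero => exact ⟨0, by simp⟩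
  | tmul a y =>
    obtain ⟨f, hf⟩ := he a
    refine ⟨fun k => f k • y, ?_⟩
    have : a ⊗ₜ[𝔽] y - ∑ k, e k ⊗ₜ[𝔽] (f k • y) =
        algebraMap A (A ⊗[𝔽] U) (a - ∑ k, f k • e k) * (1 ⊗ₜ[𝔽] y) := by
      rw [Algebra.TensorProduct.algebraMap_apply, Algebra.algebraMap_self_apply,
        Algebra.TensorProduct.tmul_mul_tmul, mul_one, one_mul, sub_tmul, sum_tmul]
      simp only [TensorProduct.tmul_smul, TensorProduct.smul_tmul']
    rw [this]
    exact Ideal.mul_mem_right _ _ (Ideal.mem_map_of_mem _ hf)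
  | add x x' hx hx' =>
    obtain ⟨y, hy⟩ := hx
    obtain ⟨y', hy'⟩ := hx'
    refine ⟨y + y', ?_⟩
    simp only [Pi.add_apply, tmul_add, Finset.sum_add_distrib]
    rw [add_sub_add_comm]
    exact Ideal.add_mem _ hy hy'

/-- The `A`-linear operator `w ↦ z w - T τ(w)` on `(A ⊗ U)^ι`. -/
noncomputable def frobOperator {ι : Type*} [Fintype ι] (z : A ⊗[𝔽] U) (T : ι → ι → A ⊗[𝔽] U) :
    (ι → A ⊗[𝔽] U) →ₗ[A] (ι → A ⊗[𝔽] U) where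
  toFun w i := z * w i - ∑ j, T i j * frob 𝔽 A U (w j)
  map_add' w w' := by
    ext i
    simp only [Pi.add_apply, map_add, mul_add, Finset.sum_add_distrib]
    ring
  map_smul' a w := by
    ext i
    simp only [Pi.smul_apply, map_smul, mul_smul_comm, RingHom.id_apply, smul_sub, Finset.smul_sum]

theorem frob_tmul (a : A) (x : U) :
    frob 𝔽 A U (a ⊗ₜ x) = a ⊗ₜ (x ^ Fintype.card 𝔽) := rfl

theorem mem_smul_top_pi {R M ι : Type*} [CommRing R] [AddCommGroup M] [Module R M] [Finite ι]
    {I : Ideal R} {v : ι → M} (h : ∀ i, v i ∈ I • (⊤ : Submodule R M)) :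
    v ∈ I • (⊤ : Submodule R (ι → M)) := by
  classical
  have := Fintype.ofFinite ι
  rw [← Finset.univ_sum_single v]
  refine Submodule.sum_mem _ fun i _ => ?_
  have := Submodule.mem_map_of_mem (f := LinearMap.single R (fun _ : ι => M) i) (h i)
  rw [Submodule.map_smul''] at this
  exact Submodule.smul_mono le_rfl le_top this

/-- Modulo a prime `ℓ` with finite residue field, `w ↦ z w - T τ(w)` is surjective if `z` is
congruent to a unit of `U`: in a basis of `A / ℓ` over `𝔽`, the equation is a system
`x = B x^{(q)} + b` over `U`. -/
theorem exists_frobOperator_sub_mem (O : Type*) [CommRing O] [IsNoetherianRing O]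
    [Algebra O U] [Algebra.IsIntegral O U]
    (hU : ∀ p : U[X], derivative p = 0 → ∃ y, p.eval y = y)
    (ℓ : Ideal A) [Module.Finite 𝔽 (A ⧸ ℓ)] {ι : Type*} [Fintype ι]
    (z : A ⊗[𝔽] U) (c : Uˣ) (hz : z - 1 ⊗ₜ (c : U) ∈ ℓ.map (algebraMap A (A ⊗[𝔽] U)))
    (T : ι → ι → A ⊗[𝔽] U) (δ : ι → A ⊗[𝔽] U) :
    ∃ w, frobOperator z T w - δ ∈ ℓ • (⊤ : Submodule A (ι → A ⊗[𝔽] U)) := by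
  let bas := Module.finBasis 𝔽 (A ⧸ ℓ)
  choose e he using fun k => Ideal.Quotient.mk_surjective (I := ℓ) (bas k)
  have hspan : ∀ a, ∃ f : _ → 𝔽, a - ∑ k, f k • e k ∈ ℓ := fun a => by
    refine ⟨bas.repr (Ideal.Quotient.mk ℓ a), ?_⟩
    rw [← Ideal.Quotient.eq, map_sum]
    refine (bas.sum_repr (Ideal.Quotient.mk ℓ a)).symm.trans
      (Finset.sum_congr rfl fun k _ => ?_)
    rw [← he]
    exact (map_smul (Ideal.Quotient.mkₐ 𝔽 ℓ) _ _).symm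
  have hdec := exists_sub_sum_tmul_mem_map (U := U) ℓ e hspan
  choose B hB using fun i j k => hdec (T i j * (e k ⊗ₜ (↑c⁻¹ : U)))
  choose b hb using fun i => hdec (δ i * (1 ⊗ₜ (↑c⁻¹ : U)))
  obtain ⟨x, hx⟩ := exists_frobenius_system_solution 𝔽 O hU
    (fun p r : ι × Fin _ => B p.1 r.1 r.2 p.2) (fun p => b p.1 p.2)
  refine ⟨fun i => ∑ k, e k ⊗ₜ x (i, k), mem_smul_top_pi fun i => ?_⟩
  rw [Ideal.smul_top_eq_map, Submodule.restrictScalars_mem]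
  let π := Ideal.Quotient.mk (ℓ.map (algebraMap A (A ⊗[𝔽] U)))
  simp only [← Ideal.Quotient.eq] at hz hB hb
  have hc : ∀ y : A ⊗[𝔽] U, π y = π (1 ⊗ₜ (c : U)) * π (y * (1 ⊗ₜ (↑c⁻¹ : U))) := fun y => by
    rw [← map_mul, mul_left_comm, Algebra.TensorProduct.tmul_mul_tmul, Units.mul_inv, mul_one,
      ← Algebra.TensorProduct.one_def, mul_one]
  have hT : π (∑ j, T i j * frob 𝔽 A U (∑ k, e k ⊗ₜ x (j, k))) =
      π (1 ⊗ₜ (c : U)) * ∑ m, π (e m ⊗ₜ ∑ p : ι × Fin _, B i p.1 p.2 m * x p ^ Fintype.card 𝔽) := by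
    simp only [map_sum, frob_tmul, Finset.mul_sum, tmul_sum]
    rw [Finset.sum_comm]
    symm
    rw [Finset.sum_comm, Fintype.sum_prod_type]
    symm
    rw [Finset.sum_comm]
    refine Finset.sum_congr rfl fun j _ => Finset.sum_congr rfl fun k _ => ?_
    have h2 : T i j * (e k ⊗ₜ (x (j, k) ^ Fintype.card 𝔽)) * (1 ⊗ₜ (↑c⁻¹ : U)) =
        T i j * (e k ⊗ₜ (↑c⁻¹ : U)) * (1 ⊗ₜ (x (j, k) ^ Fintype.card 𝔽)) := by
      simp only [mul_assoc, Algebra.TensorProduct.tmul_mul_tmul, mul_one]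
      rw [mul_comm (x (j, k) ^ _)]
    rw [hc, h2, map_mul, hB, map_sum, Finset.sum_mul, Finset.mul_sum]
    refine Finset.sum_congr rfl fun m _ => ?_
    rw [← map_mul, Algebra.TensorProduct.tmul_mul_tmul, mul_one]
  refine Ideal.Quotient.eq.1 ?_
  change π (z * _ - _) = π (δ i)
  rw [map_sub, map_mul, hT, hz, ← mul_sub, hc (δ i), hb, map_sum, map_sum, ← Finset.sum_sub_distrib]
  congr 1
  refine Finset.sum_congr rfl fun m _ => ?_
  rw [← map_sub, ← tmul_sub, hx (i, m), add_sub_cancel_left]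

/-- If a linear operator `Ψ` is surjective modulo `I`, the equation `Ψ u = μ` has an `I`-adically
convergent sequence of approximate solutions. -/
theorem exists_approximate_solutions {R V : Type*} [CommRing R] [AddCommGroup V] [Module R V]
    (I : Ideal R) (Ψ : V →ₗ[R] V) (h : ∀ δ, ∃ w, Ψ w - δ ∈ I • (⊤ : Submodule R V)) (μ : V) :
    ∃ v : ℕ → V, (∀ n, v (n + 1) - v n ∈ I ^ n • (⊤ : Submodule R V)) ∧
      ∀ n, Ψ (v n) - μ ∈ I ^ n • (⊤ : Submodule R V) := by
  have step : ∀ n, ∀ δ ∈ I ^ n • (⊤ : Submodule R V), ∃ w ∈ I ^ n • (⊤ : Submodule R V),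
      Ψ w - δ ∈ I ^ (n + 1) • (⊤ : Submodule R V) := by
    intro n δ hδ
    refine Submodule.smul_induction_on hδ ?_ ?_
    · intro r hr y _
      obtain ⟨w, hw⟩ := h y
      refine ⟨r • w, Submodule.smul_mem_smul hr trivial, ?_⟩
      rw [map_smul, ← smul_sub, pow_succ, ← smul_eq_mul, smul_assoc]
      exact Submodule.smul_mem_smul hr hw
    · rintro x y ⟨w, hw, hw'⟩ ⟨v, hv, hv'⟩
      refine ⟨w + v, add_mem hw hv, ?_⟩
      rw [map_add, add_sub_add_comm]
      exact add_mem hw' hv'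
  have next : ∀ n (v : {v // Ψ v - μ ∈ I ^ n • (⊤ : Submodule R V)}),
      ∃ v' : {v // Ψ v - μ ∈ I ^ (n + 1) • (⊤ : Submodule R V)},
        (v' : V) - v ∈ I ^ n • (⊤ : Submodule R V) := by
    rintro n ⟨v, hv⟩
    obtain ⟨w, hw, hw'⟩ := step n _ hv
    refine ⟨⟨v - w, ?_⟩, ?_⟩
    · rw [map_sub, sub_right_comm, ← neg_sub (Ψ w), neg_mem_iff]
      exact hw'
    · rw [sub_sub_cancel_left, neg_mem_iff]
      exact hw
  choose f hf using next
  let v : ∀ n : ℕ, {v // Ψ v - μ ∈ I ^ n • (⊤ : Submodule R V)} := fun n =>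
    n.rec ⟨0, by simp⟩ fun n v => f n v
  exact ⟨fun n => (v n).1, fun n => hf n (v n), fun n => (v n).2⟩

end Residue

/-! ### Finiteness of the coefficient ring -/

section CurveFiniteType

open AlgebraicGeometry CategoryTheory

theorem IsCurveCoordinateRing.finiteType {𝔽 A : Type u} [Field 𝔽] [CommRing A] [Algebra 𝔽 A]
    (h : IsCurveCoordinateRing 𝔽 A) : Algebra.FiniteType 𝔽 A := by
  obtain ⟨C, f, pt, i, hf, -, -, -, hi, -, hif⟩ := h
  have h1 : LocallyOfFiniteType (i ≫ f) := inferInstance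
  rw [hif, HasRingHomProperty.Spec_iff (P := @LocallyOfFiniteType)] at h1
  exact RingHom.finiteType_algebraMap.1 h1

end CurveFiniteType

/-! ### Adic filtrations -/

section SmulTop

variable {R S V W : Type*} [CommRing R] [CommRing S] [Algebra R S] [AddCommGroup V] [Module R V]
  [AddCommGroup W] [Module R W] [Module S W] [IsScalarTower R S W]

theorem map_mem_smul_top (I : Ideal R) (f : V →ₗ[R] W) {x : V}
    (hx : x ∈ I • (⊤ : Submodule R V)) : f x ∈ I • (⊤ : Submodule R W) := by
  have := Submodule.mem_map_of_mem (f := f) hx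
  rw [Submodule.map_smul''] at this
  exact Submodule.smul_mono le_rfl le_top this

/-- If `a ∈ I` and `b` is a unit, `a - b` is injective modulo every power of `I`. -/
theorem mem_smul_top_of_sub_smul_mem {I : Ideal R} {a : R} (ha : a ∈ I) {b : S} (hb : IsUnit b)
    (n : ℕ) {y : W} (hy : (algebraMap R S a - b) • y ∈ I ^ n • (⊤ : Submodule R W)) :
    y ∈ I ^ n • (⊤ : Submodule R W) := by
  obtain ⟨b, rfl⟩ := hb
  have key : ∀ k ≤ n, y ∈ I ^ k • (⊤ : Submodule R W) := by
    intro k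
    induction k with
    | zero => intro; simp
    | succ k ih =>
      intro hk
      have h1 : a • y ∈ I ^ (k + 1) • (⊤ : Submodule R W) := by
        rw [pow_succ', ← smul_eq_mul, smul_assoc]
        exact Submodule.smul_mem_smul ha (ih (by omega))
      have h2 := sub_mem h1 (Submodule.smul_mono_left (Ideal.pow_le_pow_right hk) hy)
      have h3 := map_mem_smul_top _ (Algebra.lsmul R R W (↑b⁻¹ : S)) h2
      rw [sub_smul, algebraMap_smul, sub_sub_cancel, Algebra.lsmul_coe] at h3
      simpa only [smul_smul, Units.inv_mul, one_smul] using h3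
  exact key n le_rfl

theorem mem_smul_top_of_sub_pow_smul_mem {I : Ideal R} {a : R} (ha : a ∈ I) {b : S}
    (hb : IsUnit b) (n k : ℕ) {y : W}
    (hy : (algebraMap R S a - b) ^ k • y ∈ I ^ n • (⊤ : Submodule R W)) :
    y ∈ I ^ n • (⊤ : Submodule R W) := by
  induction k with
  | zero => simpa using hy
  | succ k ih =>
    rw [pow_succ', mul_smul] at hy
    exact ih (mem_smul_top_of_sub_smul_mem ha hb n hy)

end SmulTop

/-! ### Change of the ring `R` in `A ⊗ R` -/

section ExtendRing

variable {𝔽 A R S T : Type u} [Field 𝔽] [CommRing A] [Algebra 𝔽 A]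
  [CommRing R] [Algebra 𝔽 R] [CommRing S] [Algebra 𝔽 S] [Algebra R S] [IsScalarTower 𝔽 R S]
  [CommRing T] [Algebra 𝔽 T] [Algebra S T] [Algebra R T] [IsScalarTower 𝔽 R T]
  [IsScalarTower 𝔽 S T] [IsScalarTower R S T]

theorem extendRing_extendRing (x : A ⊗[𝔽] R) :
    extendRing 𝔽 A S T (extendRing 𝔽 A R S x) = extendRing 𝔽 A R T x := by
  induction x using TensorProduct.induction_on with
  | zero => simp
  | tmul a x => simp [extendRing, ← IsScalarTower.algebraMap_apply R S T]
  | add x y hx hy => simp only [map_add, hx, hy]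

theorem extendRing_frob [Fintype 𝔽] (x : A ⊗[𝔽] R) :
    extendRing 𝔽 A R S (frob 𝔽 A R x) = frob 𝔽 A S (extendRing 𝔽 A R S x) := by
  induction x using TensorProduct.induction_on with
  | zero => simp
  | tmul a x => simp [extendRing, frob]
  | add x y hx hy => simp only [map_add, hx, hy]

theorem extendRing_jGen (κ : A →ₐ[𝔽] R) (a : A) :
    extendRing 𝔽 A R S (jGen κ a) = jGen ((IsScalarTower.toAlgHom 𝔽 R S).comp κ) a := by
  simp [jGen, extendRing]

end ExtendRing

/-! ### Integral models -/

section Models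

variable {𝔽 A R S : Type u} [Field 𝔽] [Fintype 𝔽] [CommRing A] [Algebra 𝔽 A]
  [CommRing R] [Algebra 𝔽 R] [CommRing S] [Algebra 𝔽 S] [Algebra R S] [IsScalarTower 𝔽 R S]

open Filter in
theorem eventually_exists_pow_smul_eq_toJInv {κ : A →ₐ[𝔽] R} {κ' : A →ₐ[𝔽] S}
    (hκ' : κ' = (IsScalarTower.toAlgHom 𝔽 R S).comp κ) {M : AMotive κ'} {N : Submodule (A ⊗[𝔽] R) M.carrier}
    {x : jInv κ' M.carrier} {a : A}
    (hx : ∃ n, ∃ y ∈ N, jGen κ' a ^ n • x =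
      toJInv _ M.carrier y) : ∀ᶠ k in atTop, ∃ y ∈ N,
      jGen κ' a ^ k • x = toJInv _ M.carrier y := by
  obtain ⟨n, y, hy, e⟩ := hx
  refine eventually_atTop.2 ⟨n, fun k hk => ⟨jGen κ a ^ (k - n) • y, N.smul_mem _ hy, ?_⟩⟩
  have : jGen κ a ^ (k - n) • y =
      jGen κ' a ^ (k - n) • y := by
    have hj : jGen κ' a = extendRing 𝔽 A R S (jGen κ a) := by rw [hκ', extendRing_jGen]
    rw [hj, ← map_pow]
    rfl
  rw [this, map_smul, ← e, smul_smul, ← pow_add, Nat.sub_add_cancel hk]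

/-- For `m ∈ M_R[𝔧⁻¹]`, some multiple `j ^ k m`, with `j = a ⊗ 1 - 1 ⊗ κ(a)`, lies in a single
finitely generated `τ`-stable module `N`. As the integral models form a directed family, one of them
will do, unless there are none; then `M_R = 0` and `N = 0` is taken. -/
theorem exists_model_of_mem_subJInv_maximalModel {κ : A →ₐ[𝔽] R} {κ' : A →ₐ[𝔽] S}
    (hκ' : κ' = (IsScalarTower.toAlgHom 𝔽 R S).comp κ) {M : AMotive κ'}
    {m : jInv κ' M.carrier}
    (hm : m ∈ subJInv (maximalModel R M)) {a : A} (ha : a ∉ Set.range (algebraMap 𝔽 A)) :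
    ∃ N : Submodule (A ⊗[𝔽] R) M.carrier, N.FG ∧ (∀ x ∈ N, M.phi x ∈ subJInv N) ∧
      ∃ k, ∃ y ∈ N, jGen κ' a ^ k • m =
        toJInv _ M.carrier y := by
  subst hκ'
  obtain ⟨k, hk⟩ := hm
  obtain ⟨y, hy, e⟩ := hk a ha
  rcases Set.eq_empty_or_nonempty {L : Submodule (A ⊗[𝔽] R) M.carrier | IsIntegralModel M L}
    with h0 | h0
  · rw [maximalModel, h0, sSup_empty] at hy
    refine ⟨⊥, Submodule.fg_bot, fun x hx => ?_, k, y, hy, e⟩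
    rw [Submodule.mem_bot] at hx
    exact ⟨0, fun _ _ => ⟨0, zero_mem _, by simp [hx]⟩⟩
  · obtain ⟨N, hN, hyN⟩ := (Submodule.mem_sSup_of_directed h0 fun N hN N' hN' =>
      ⟨N ⊔ N', hN.sup hN', le_sup_left, le_sup_right⟩).1 hy
    exact ⟨N, hN.fg, hN.stable, k, y, hyN, e⟩

end Models

/-! ### Unramified approximate solutions -/

section Approximation

open Polynomial

variable {𝔽 A O F L U : Type u} [Field 𝔽] [Fintype 𝔽] [CommRing A] [Algebra 𝔽 A]
  [CommRing O] [Algebra 𝔽 O] [Field F] [Algebra 𝔽 F] [Algebra O F] [IsScalarTower 𝔽 O F]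
  [Field L] [Algebra 𝔽 L] [Algebra F L] [IsScalarTower 𝔽 F L]
  [Algebra O L] [IsScalarTower O F L] [IsScalarTower 𝔽 O L]
  [CommRing U] [Algebra 𝔽 U] [Algebra O U] [IsScalarTower 𝔽 O U]
  [Algebra U L] [IsScalarTower 𝔽 U L] [IsScalarTower O U L]

variable (F L) in
/-- The `A`-linear map `(A ⊗ U)^ι → X_L`, `w ↦ ∑ w_i ⊗ g_i`. -/
noncomputable def combination {ι : Type*} [Fintype ι] {X : Type u} [AddCommGroup X]
    [Module (A ⊗[𝔽] F) X] (g : ι → X) : (ι → A ⊗[𝔽] U) →ₗ[A] BaseChange 𝔽 A F L X where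
  toFun w := ∑ i, extendRing 𝔽 A U L (w i) ⊗ₜ[A ⊗[𝔽] F] g i
  map_add' w w' := by simp only [Pi.add_apply, map_add, add_tmul, Finset.sum_add_distrib]
  map_smul' a w := by
    simp only [Pi.smul_apply, map_smul, RingHom.id_apply, Finset.smul_sum, smul_tmul']

theorem galoisMap_combination {ι : Type*} [Fintype ι] {X : Type u} [AddCommGroup X]
    [Module (A ⊗[𝔽] F) X] (g : ι → X) (w : ι → A ⊗[𝔽] U) (σ : L ≃ₐ[F] L)
    (hσ : ∀ x : U, σ (algebraMap U L x) = algebraMap U L x) :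
    galoisMap σ X (combination F L g w) = combination F L g w := by
  refine (map_sum _ _ _).trans (Finset.sum_congr rfl fun i _ => ?_)
  have h : ∀ x : A ⊗[𝔽] U, Algebra.TensorProduct.map (AlgHom.id A A)
      (σ.restrictScalars 𝔽 : L →ₐ[𝔽] L) (extendRing 𝔽 A U L x) = extendRing 𝔽 A U L x := by
    intro x
    induction x using TensorProduct.induction_on with
    | zero => simp
    | tmul a x => simp [extendRing, hσ]
    | add x y hx hy => simp only [map_add, hx, hy]
  exact congrArg (· ⊗ₜ[A ⊗[𝔽] F] g i) (h (w i))

variable {κ : A →ₐ[𝔽] O}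

/-- For `ξ = ∑ w_i ⊗ G_i`, elements `P_j` (the images of generators under `τ`) and `m` of a module
`X` that are combinations of the `G_i` after multiplication by `j ^ k`, the equation
`ξ = τ(ξ) + m` multiplied by `j ^ k` is the equation `j ^ k w - T τ(w) = μ`. -/
theorem pow_smul_combination {ι : Type*} [Fintype ι] {X : Type u} [AddCommGroup X]
    [Module (A ⊗[𝔽] F) X] (G P : ι → X) (m : X) (z : A ⊗[𝔽] O) (T : ι → ι → A ⊗[𝔽] O)
    (hT : ∀ j, extendRing 𝔽 A O F z • P j = ∑ i, extendRing 𝔽 A O F (T i j) • G i)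
    (μ : ι → A ⊗[𝔽] O)
    (hm : extendRing 𝔽 A O F z • m = ∑ i, extendRing 𝔽 A O F (μ i) • G i) (w : ι → A ⊗[𝔽] U) :
    extendRing 𝔽 A O L z • (combination F L G w -
        ∑ j, frob 𝔽 A L (extendRing 𝔽 A U L (w j)) ⊗ₜ[A ⊗[𝔽] F] P j - 1 ⊗ₜ[A ⊗[𝔽] F] m) =
    combination F L G (frobOperator (extendRing 𝔽 A O U z)
      (fun i j => extendRing 𝔽 A O U (T i j)) w - fun i => extendRing 𝔽 A O U (μ i)) := by
  have hs : ∀ (s : A ⊗[𝔽] O) (y : A ⊗[𝔽] L) (x : X), y ⊗ₜ[A ⊗[𝔽] F] (extendRing 𝔽 A O F s • x) =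
      (extendRing 𝔽 A O L s * y) ⊗ₜ[A ⊗[𝔽] F] x := by
    intro s y x
    rw [tmul_smul, smul_tmul', Algebra.smul_def, ← extendRing_extendRing (S := F) (T := L)]
    rfl
  have hj : ∀ (y : A ⊗[𝔽] L) (x : X), extendRing 𝔽 A O L z • (y ⊗ₜ[A ⊗[𝔽] F] x) =
      y ⊗ₜ[A ⊗[𝔽] F] (extendRing 𝔽 A O F z • x) := by
    intro y x
    rw [hs, smul_tmul', smul_eq_mul]
  have hsum : ∀ (y : A ⊗[𝔽] L) (t : ι → A ⊗[𝔽] O),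
      y ⊗ₜ[A ⊗[𝔽] F] (∑ i, extendRing 𝔽 A O F (t i) • G i) =
        ∑ i, (extendRing 𝔽 A O L (t i) * y) ⊗ₜ[A ⊗[𝔽] F] G i := by
    intro y t
    rw [tmul_sum]
    exact Finset.sum_congr rfl fun i _ => hs _ _ _
  have e1 : combination F L G w = ∑ i, extendRing 𝔽 A U L (w i) ⊗ₜ[A ⊗[𝔽] F] G i := rfl
  have e3 : ∀ j, extendRing 𝔽 A O L z •
      (frob 𝔽 A L (extendRing 𝔽 A U L (w j)) ⊗ₜ[A ⊗[𝔽] F] P j) =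
      ∑ i, (extendRing 𝔽 A O L (T i j) * frob 𝔽 A L (extendRing 𝔽 A U L (w j))) ⊗ₜ[A ⊗[𝔽] F]
        G i := fun j => by
    rw [hj, hT, hsum]
  rw [e1, smul_sub, smul_sub, hj, hm, hsum, Finset.smul_sum, Finset.smul_sum,
    Finset.sum_congr rfl fun j _ => e3 j, Finset.sum_comm, ← Finset.sum_sub_distrib,
    ← Finset.sum_sub_distrib]
  refine Finset.sum_congr rfl fun i _ => ?_
  rw [smul_tmul', ← sum_tmul, ← sub_tmul, ← sub_tmul]
  refine congrArg (· ⊗ₜ[A ⊗[𝔽] F] G i) ?_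
  change _ = extendRing 𝔽 A U L (extendRing 𝔽 A O U z * w i -
    ∑ j, extendRing 𝔽 A O U (T i j) * frob 𝔽 A U (w j) - extendRing 𝔽 A O U (μ i))
  simp only [map_sub, map_sum, map_mul, extendRing_extendRing, extendRing_frob, mul_one,
    smul_eq_mul]

theorem combination_sub_mem_smul_top {ℓ : Ideal A} {a : A} (ha : a ∈ ℓ) (hκa : IsUnit (κ a))
    {ι : Type*} [Fintype ι] {X : Type u} [AddCommGroup X] [Module (A ⊗[𝔽] F) X]
    (G P : ι → X) (m : X) (k : ℕ) (T : ι → ι → A ⊗[𝔽] O)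
    (hT : ∀ j, extendRing 𝔽 A O F (jGen κ a ^ k) • P j = ∑ i, extendRing 𝔽 A O F (T i j) • G i)
    (μ : ι → A ⊗[𝔽] O)
    (hm : extendRing 𝔽 A O F (jGen κ a ^ k) • m = ∑ i, extendRing 𝔽 A O F (μ i) • G i)
    {w : ι → A ⊗[𝔽] U} {n : ℕ}
    (hw : frobOperator (extendRing 𝔽 A O U (jGen κ a ^ k))
      (fun i j => extendRing 𝔽 A O U (T i j)) w - (fun i => extendRing 𝔽 A O U (μ i)) ∈
        ℓ ^ n • (⊤ : Submodule A (ι → A ⊗[𝔽] U))) :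
    combination F L G w - ∑ j, frob 𝔽 A L (extendRing 𝔽 A U L (w j)) ⊗ₜ[A ⊗[𝔽] F] P j -
      1 ⊗ₜ[A ⊗[𝔽] F] m ∈ ℓ ^ n • (⊤ : Submodule A (BaseChange 𝔽 A F L X)) := by
  have h := map_mem_smul_top (ℓ ^ n) (combination F L G) hw
  rw [← pow_smul_combination G P m (jGen κ a ^ k) T hT μ hm w] at h
  have hj : extendRing 𝔽 A O L (jGen κ a) =
      algebraMap A (A ⊗[𝔽] L) a - Algebra.TensorProduct.includeRight (algebraMap O L (κ a)) := by
    simp [jGen, extendRing]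
  rw [map_pow, hj] at h
  exact mem_smul_top_of_sub_pow_smul_mem ha
    ((hκa.map (algebraMap O L)).map (Algebra.TensorProduct.includeRight (R := 𝔽) (A := A))) n k h

theorem combination_sub_combination_mem_smul_top {I : Ideal A} {ι : Type*} [Fintype ι]
    {X : Type u} [AddCommGroup X] [Module (A ⊗[𝔽] F) X] (g : ι → X) {w w' : ι → A ⊗[𝔽] U}
    (h : w - w' ∈ I • (⊤ : Submodule A (ι → A ⊗[𝔽] U))) :
    combination F L g w - combination F L g w' ∈
      I • (⊤ : Submodule A (BaseChange 𝔽 A F L X)) := by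
  rw [← map_sub]
  exact map_mem_smul_top I (combination F L g) h

theorem baseChangeMap_combination {ι : Type*} [Fintype ι] {X Y : Type u} [AddCommGroup X]
    [Module (A ⊗[𝔽] F) X] [AddCommGroup Y] [Module (A ⊗[𝔽] F) Y] (f : X →ₗ[A ⊗[𝔽] F] Y)
    (g : ι → X) (w : ι → A ⊗[𝔽] U) :
    baseChangeMap L f (combination F L g w) = combination F L (fun i => f (g i)) w :=
  map_sum (baseChangeMap L f) _ _

theorem phiBaseChange_combination {κ : A →ₐ[𝔽] F} (M : AMotive κ) {ι : Type*} [Fintype ι]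
    (g : ι → M.carrier) (w : ι → A ⊗[𝔽] U) :
    M.phiBaseChange L (combination F L g w) =
      ∑ j, frob 𝔽 A L (extendRing 𝔽 A U L (w j)) ⊗ₜ[A ⊗[𝔽] F] M.phi (g j) :=
  map_sum (M.phiBaseChange L) _ _

/-- In terms of generators `g_i` of an integral model, `τ_M` and a given element `m` of
`M_O[𝔧⁻¹]` are described by a matrix and a vector over `A ⊗ O`, after multiplication by a power of
an element of `𝔧`. -/
theorem exists_generators_of_mem_subJInv {κ' : A →ₐ[𝔽] F}
    (hκ' : κ' = (IsScalarTower.toAlgHom 𝔽 O F).comp κ) (M : AMotive κ')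
    {a : A} (ha' : a ∉ Set.range (algebraMap 𝔽 A))
    {m : jInv κ' M.carrier}
    (hm : m ∈ subJInv (maximalModel O M)) :
    ∃ (r : ℕ) (g : Fin r → M.carrier) (k : ℕ) (T : Fin r → Fin r → A ⊗[𝔽] O)
      (μ : Fin r → A ⊗[𝔽] O),
      (∀ j, extendRing 𝔽 A O F (jGen κ a ^ k) • M.phi (g j) =
        ∑ i, extendRing 𝔽 A O F (T i j) •
          toJInv κ' M.carrier (g i)) ∧
      extendRing 𝔽 A O F (jGen κ a ^ k) • m =
        ∑ i, extendRing 𝔽 A O F (μ i) •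
          toJInv κ' M.carrier (g i) := by
  obtain ⟨N, hNfg, hN, hmN⟩ := exists_model_of_mem_subJInv_maximalModel hκ' hm ha'
  obtain ⟨r, g, hg⟩ := Submodule.fg_iff_exists_fin_generating_family.1 hNfg
  have hgN : ∀ j, M.phi (g j) ∈ subJInv N := fun j => hN _ (hg ▸ Submodule.subset_span ⟨j, rfl⟩)
  obtain ⟨k, ⟨y, hy, ey⟩, hk⟩ := ((eventually_exists_pow_smul_eq_toJInv hκ' hmN).and
    (Filter.eventually_all.2 fun j => eventually_exists_pow_smul_eq_toJInv hκ'
      ((hgN j).imp fun _ h => h a ha'))).exists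
  choose t ht et using hk
  have hcoef : ∀ x ∈ N, ∃ c : Fin r → A ⊗[𝔽] O, toJInv κ'
      M.carrier x = ∑ i, extendRing 𝔽 A O F (c i) • toJInv _ M.carrier (g i) := fun x hx => by
    obtain ⟨c, rfl⟩ := (Submodule.mem_span_range_iff_exists_fun _).1 (hg ▸ hx)
    refine ⟨c, (map_sum _ _ _).trans (Finset.sum_congr rfl fun i _ => ?_)⟩
    exact map_smul (toJInv κ' M.carrier) (extendRing 𝔽 A O F (c i)) (g i)
  choose T hT using fun j => hcoef (t j) (ht j)
  obtain ⟨μ, hμ⟩ := hcoef y hy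
  refine ⟨r, g, k, fun i j => T j i, μ, ?_⟩
  have hext : extendRing 𝔽 A O F (jGen κ a ^ k) =
      jGen κ' a ^ k := by
    rw [map_pow, extendRing_jGen, ← hκ']
  exact ⟨fun j => by rw [hext, et, hT], by rw [hext, ey, hμ]⟩

/-- The equation `ξ = τ_M(τ^*ξ) + m` has an `ℓ`-adically convergent sequence of approximate
solutions that are defined over `U`. -/
theorem exists_approximate_solutions_of_subJInv {κ' : A →ₐ[𝔽] F}
    (hκ' : κ' = (IsScalarTower.toAlgHom 𝔽 O F).comp κ) (M : AMotive κ')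
    [IsNoetherianRing O] [Algebra.IsIntegral O U]
    (hU : ∀ p : U[X], derivative p = 0 → ∃ y, p.eval y = y)
    {ℓ : Ideal A} [Module.Finite 𝔽 (A ⧸ ℓ)] {a : A} (ha : a ∈ ℓ) (hκa : IsUnit (κ a))
    (ha' : a ∉ Set.range (algebraMap 𝔽 A))
    {m : jInv κ' M.carrier}
    (hm : m ∈ subJInv (maximalModel O M)) :
    ∃ ξ : ℕ → BaseChange 𝔽 A F L M.carrier,
      (∀ n, ξ (n + 1) - ξ n ∈ ℓ ^ n • (⊤ : Submodule A (BaseChange 𝔽 A F L M.carrier))) ∧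
      (∀ n, baseChangeMap L (toJInv _ M.carrier) (ξ n) - M.phiBaseChange L (ξ n) -
        1 ⊗ₜ[A ⊗[𝔽] F] m ∈ ℓ ^ n • (⊤ : Submodule A (BaseChange 𝔽 A F L
          (jInv κ' M.carrier)))) ∧
      ∀ σ : L ≃ₐ[F] L, (∀ x : U, σ (algebraMap U L x) = algebraMap U L x) →
        ∀ n, galoisMap σ M.carrier (ξ n) = ξ n := by
  obtain ⟨r, g, k, T, μ, hT, hμ⟩ := exists_generators_of_mem_subJInv hκ' M ha' hm
  have hmod : extendRing 𝔽 A O U (jGen κ a) - 1 ⊗ₜ (algebraMap O U (-κ a)) ∈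
      ℓ.map (algebraMap A (A ⊗[𝔽] U)) := by
    have : extendRing 𝔽 A O U (jGen κ a) - 1 ⊗ₜ (algebraMap O U (-κ a)) =
        algebraMap A (A ⊗[𝔽] U) a := by
      simp [jGen, extendRing, tmul_neg]
    rw [this]
    exact Ideal.mem_map_of_mem _ ha
  let c : Uˣ := (hκa.neg.map (algebraMap O U)).unit ^ k
  have hz : extendRing 𝔽 A O U (jGen κ a ^ k) - 1 ⊗ₜ (c : U) ∈
      ℓ.map (algebraMap A (A ⊗[𝔽] U)) := by
    rw [← Ideal.Quotient.eq] at hmod ⊢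
    rw [map_pow, map_pow, hmod, ← map_pow, Algebra.TensorProduct.tmul_pow, one_pow]
    rfl
  obtain ⟨v, hv, hv'⟩ := exists_approximate_solutions ℓ _
    (exists_frobOperator_sub_mem O hU ℓ _ c hz fun i j => extendRing 𝔽 A O U (T i j))
    (fun i => extendRing 𝔽 A O U (μ i))
  refine ⟨fun n => combination F L g (v n), fun n => ?_, fun n => ?_, fun σ hσ n =>
    galoisMap_combination g (v n) σ hσ⟩
  · exact combination_sub_combination_mem_smul_top g (hv n)
  · rw [baseChangeMap_combination, phiBaseChange_combination]
    exact combination_sub_mem_smul_top ha hκa _ _ m k T hT μ hμ (hv' n)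

end Approximation

/-! ### Sections of the extensions `ι(m)` -/

section Twist

variable {𝔽 A R : Type u} [Field 𝔽] [Fintype 𝔽] [CommRing A] [Algebra 𝔽 A]
  [CommRing R] [Algebra 𝔽 R] {κ : A →ₐ[𝔽] R}

theorem jInvMap_toJInv {X Y : Type u} [AddCommGroup X] [Module (A ⊗[𝔽] R) X] [AddCommGroup Y]
    [Module (A ⊗[𝔽] R) Y] (f : X →ₗ[A ⊗[𝔽] R] Y) (x : X) :
    jInvMap κ f (toJInv κ X x) = toJInv κ Y (f x) := rfl

theorem AMotive.phi_apply (M : AMotive κ) (x : M.carrier) :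
    M.phi x = M.tau (toJInv κ _ (TauStar.ofModule M.carrier x)) := rfl

theorem AMotive.Commutes.jInvMap_phi {M N : AMotive κ}
    {f : M.carrier →ₗ[A ⊗[𝔽] R] N.carrier} (hf : M.Commutes N f) (x : M.carrier) :
    jInvMap κ f (M.phi x) = N.phi (f x) := by
  rw [M.phi_apply, hf, jInvMap_toJInv]
  rfl

theorem jInvSMul_toJInv_one {X : Type u} [AddCommGroup X] [Module (A ⊗[𝔽] R) X] (m : jInv κ X) :
    jInvSMul κ m (toJInv κ _ 1) = m := by
  refine Subtype.ext ?_
  change (TensorProduct.rid (A ⊗[𝔽] R) (FractionRing (A ⊗[𝔽] R))) (1 ⊗ₜ 1) • (m : FractionRing (A ⊗[𝔽] R) ⊗[A ⊗[𝔽] R] X) = m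
  rw [TensorProduct.rid_tmul, one_smul, one_smul]

theorem jInvProd_symm_shear_toJInv_one {X : Type u} [AddCommGroup X] [Module (A ⊗[𝔽] R) X]
    (m : jInv κ X) :
    (jInvProd κ X (A ⊗[𝔽] R)).symm (shear (jInvSMul κ m) (0, toJInv κ _ 1)) =
      jInvMap κ (LinearMap.inl _ X (A ⊗[𝔽] R)) m + toJInv κ _ (0, 1) := by
  rw [LinearEquiv.symm_apply_eq, map_add, jInvProd_jInvMap_inl]
  refine Prod.ext ?_ ?_
  · exact ((zero_add _).trans (jInvSMul_toJInv_one m)).trans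
      ((add_zero m).symm.trans (congrArg (m + ·) (map_zero (toJInv κ X)).symm))
  · exact (zero_add (toJInv κ (A ⊗[𝔽] R) 1)).symm

theorem AMotive.twist_phi (M : AMotive κ) (m : jInv κ M.carrier) :
    (M.twist m).phi (0, 1) =
      jInvMap κ (LinearMap.inl _ M.carrier (A ⊗[𝔽] R)) m + toJInv κ _ (0, 1) := by
  have h1 : TauStar.prod 𝔽 A R M.carrier (A ⊗[𝔽] R) (TauStar.ofModule _ (0, 1)) =
      (0, TauStar.ofModule _ 1) := Prod.ext (TensorProduct.tmul_zero _ _) rfl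
  have h2 : TauStar.unit 𝔽 A R (TauStar.ofModule _ 1) = 1 := by
    change frob 𝔽 A R 1 * 1 = 1
    rw [map_one, mul_one]
  have h3 : LinearEquiv.prodCongr M.tau (jInvCongr κ (TauStar.unit 𝔽 A R))
      (jInvProd κ _ _ (toJInv κ _ (0, TauStar.ofModule _ 1))) =
        (M.tau (toJInv κ _ 0), toJInv κ _ (TauStar.unit 𝔽 A R (TauStar.ofModule _ 1))) := rfl
  have h4 : (M.twist m).phi (0, 1) = (jInvProd κ M.carrier (A ⊗[𝔽] R)).symm
      (shear (jInvSMul κ m) (LinearEquiv.prodCongr M.tau (jInvCongr κ (TauStar.unit 𝔽 A R))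
        (jInvProd κ _ _ (toJInv κ _ (0, TauStar.ofModule _ 1))))) :=
    congrArg (fun z => (jInvProd κ M.carrier (A ⊗[𝔽] R)).symm (shear (jInvSMul κ m)
      (LinearEquiv.prodCongr M.tau (jInvCongr κ (TauStar.unit 𝔽 A R))
        (jInvProd κ _ _ (toJInv κ _ z))))) h1
  rw [h3, h2, map_zero, map_zero] at h4
  exact h4.trans (jInvProd_symm_shear_toJInv_one m)

/-- An extension in the class `ι(m)` has a section `s` of `1` with `τ_E(τ^*s) = s + m`. -/
theorem Extension.exists_section_of_mk_eq_iota {M : AMotive κ} {m : jInv κ M.carrier}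
    {E : Extension M} (h : iota M m = (⟦E⟧ : Quotient (Extension.setoid M))) :
    ∃ s : E.obj.carrier, E.proj.toLinearMap s = (1 : A ⊗[𝔽] R) ∧
      E.obj.phi s = jInvMap κ E.inj.toLinearMap m + toJInv κ _ s := by
  obtain ⟨f, hf, h1, h2⟩ := Quotient.exact h
  refine ⟨f ((0, 1) : M.carrier × (A ⊗[𝔽] R)), h2 _, ?_⟩
  have h3 : f.toLinearMap ∘ₗ LinearMap.inl _ M.carrier (A ⊗[𝔽] R) = E.inj.toLinearMap :=
    LinearMap.ext h1
  have h4 := hf.jInvMap_phi ((0, 1) : M.carrier × (A ⊗[𝔽] R))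
  have h5 : jInvMap κ E.inj.toLinearMap m =
      jInvMap κ f.toLinearMap (jInvMap κ (LinearMap.inl _ M.carrier (A ⊗[𝔽] R)) m) := by
    rw [← h3]
    exact LinearMap.congr_fun (jInvMap_comp κ f.toLinearMap (LinearMap.inl _ M.carrier _)) m
  refine h4.symm.trans ((congrArg (jInvMap κ f.toLinearMap) (M.twist_phi m)).trans ?_)
  exact (map_add _ _ _).trans (congrArg (· + _) h5.symm)

end Twist

/-! ### Splitting over the inertia group -/

section Splitting

variable {𝔽 A F L : Type u} [Field 𝔽] [Fintype 𝔽] [CommRing A] [Algebra 𝔽 A]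
  [Field F] [Algebra 𝔽 F] [Field L] [Algebra 𝔽 L] [Algebra F L] [IsScalarTower 𝔽 F L]
  {κ : A →ₐ[𝔽] F}

theorem baseChangeMap_comp_apply {X Y Z : Type u} [AddCommGroup X] [Module (A ⊗[𝔽] F) X]
    [AddCommGroup Y] [Module (A ⊗[𝔽] F) Y] [AddCommGroup Z] [Module (A ⊗[𝔽] F) Z]
    (g : Y →ₗ[A ⊗[𝔽] F] Z) (f : X →ₗ[A ⊗[𝔽] F] Y) (x : BaseChange 𝔽 A F L X) :
    baseChangeMap L g (baseChangeMap L f x) = baseChangeMap L (g ∘ₗ f) x :=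
  (LinearMap.lTensor_comp_apply _ g f x).symm

theorem baseChangeMap_zero_apply {X Y : Type u} [AddCommGroup X] [Module (A ⊗[𝔽] F) X]
    [AddCommGroup Y] [Module (A ⊗[𝔽] F) Y] (x : BaseChange 𝔽 A F L X) :
    baseChangeMap L (0 : X →ₗ[A ⊗[𝔽] F] Y) x = 0 :=
  LinearMap.congr_fun (LinearMap.lTensor_zero (A ⊗[𝔽] L)) x

theorem galoisMap_baseChangeMap {X Y : Type u} [AddCommGroup X] [Module (A ⊗[𝔽] F) X]
    [AddCommGroup Y] [Module (A ⊗[𝔽] F) Y] (f : X →ₗ[A ⊗[𝔽] F] Y) (σ : L ≃ₐ[F] L)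
    (x : BaseChange 𝔽 A F L X) :
    galoisMap σ Y (baseChangeMap L f x) = baseChangeMap L f (galoisMap σ X x) := by
  induction x using TensorProduct.induction_on with
  | zero => simp only [map_zero]
  | tmul y x => rfl
  | add x y hx hy => simp only [map_add, hx, hy]

theorem galoisMap_one_tmul {X : Type u} [AddCommGroup X] [Module (A ⊗[𝔽] F) X] (σ : L ≃ₐ[F] L)
    (x : X) : galoisMap σ X ((1 : A ⊗[𝔽] L) ⊗ₜ[A ⊗[𝔽] F] x) = 1 ⊗ₜ[A ⊗[𝔽] F] x :=
  congrArg (· ⊗ₜ[A ⊗[𝔽] F] x) (map_one (Algebra.TensorProduct.map (AlgHom.id A A)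
    (σ.restrictScalars 𝔽 : L →ₐ[𝔽] L)))

theorem AMotive.Commutes.phiBaseChange {M N : AMotive κ}
    {f : M.carrier →ₗ[A ⊗[𝔽] F] N.carrier} (hf : M.Commutes N f)
    (x : BaseChange 𝔽 A F L M.carrier) :
    N.phiBaseChange L (baseChangeMap L f x) =
      baseChangeMap L (jInvMap κ f) (M.phiBaseChange L x) := by
  induction x using TensorProduct.induction_on with
  | zero => simp only [map_zero]
  | tmul y x => exact congrArg (frob 𝔽 A L y ⊗ₜ[A ⊗[𝔽] F] ·) (hf.jInvMap_phi x).symm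
  | add x y hx hy => simp only [map_add, hx, hy]

theorem AMotive.phiBaseChange_one_tmul (M : AMotive κ) (x : M.carrier) :
    M.phiBaseChange L ((1 : A ⊗[𝔽] L) ⊗ₜ[A ⊗[𝔽] F] x) = 1 ⊗ₜ[A ⊗[𝔽] F] M.phi x :=
  congrArg (· ⊗ₜ[A ⊗[𝔽] F] M.phi x) (map_one (frob 𝔽 A L))

theorem baseChangeMap_one_tmul {X Y : Type u} [AddCommGroup X] [Module (A ⊗[𝔽] F) X]
    [AddCommGroup Y] [Module (A ⊗[𝔽] F) Y] (f : X →ₗ[A ⊗[𝔽] F] Y) (x : X) :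
    baseChangeMap L f ((1 : A ⊗[𝔽] L) ⊗ₜ[A ⊗[𝔽] F] x) = 1 ⊗ₜ[A ⊗[𝔽] F] f x := rfl

set_option maxHeartbeats 800000 in
/-- If `ξ` solves `ξ = τ_M(τ^*ξ) + m` modulo `I`, then `ξ + s` is fixed by `τ_E` modulo `I`. -/
theorem Extension.tate_sub_mem_smul_top {M : AMotive κ} (E : Extension M)
    {I : Ideal A} {m : jInv κ M.carrier} {s : E.obj.carrier}
    (hs' : E.obj.phi s = jInvMap κ E.inj.toLinearMap m + toJInv κ _ s)
    {ξ : BaseChange 𝔽 A F L M.carrier}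
    (hξ' : baseChangeMap L (toJInv κ M.carrier) ξ - M.phiBaseChange L ξ -
      1 ⊗ₜ[A ⊗[𝔽] F] m ∈ I • (⊤ : Submodule A (BaseChange 𝔽 A F L (jInv κ M.carrier)))) :
    baseChangeMap L (toJInv κ E.obj.carrier)
        (baseChangeMap L E.inj.toLinearMap ξ + (1 : A ⊗[𝔽] L) ⊗ₜ[A ⊗[𝔽] F] s) -
      E.obj.phiBaseChange L
        (baseChangeMap L E.inj.toLinearMap ξ + (1 : A ⊗[𝔽] L) ⊗ₜ[A ⊗[𝔽] F] s) ∈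
      I • (⊤ : Submodule A (BaseChange 𝔽 A F L (jInv κ E.obj.carrier))) := by
  have h1 := map_mem_smul_top I (baseChangeMap L (jInvMap κ E.inj.toLinearMap)) hξ'
  have h2 : baseChangeMap L (jInvMap κ E.inj.toLinearMap)
      (baseChangeMap L (toJInv κ M.carrier) ξ) =
        baseChangeMap L (toJInv κ E.obj.carrier) (baseChangeMap L E.inj.toLinearMap ξ) := by
    rw [baseChangeMap_comp_apply, baseChangeMap_comp_apply]
    rfl
  have h3 := E.inj.commutes.phiBaseChange ξ
  have h4 := E.obj.phiBaseChange_one_tmul (L := L) s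
  rw [hs', tmul_add] at h4
  rw [map_sub, map_sub, h2, ← h3, baseChangeMap_one_tmul] at h1
  rw [map_add, map_add, h4, baseChangeMap_one_tmul, add_sub_add_comm, sub_add_cancel_right,
    ← sub_eq_add_neg]
  exact h1

/-- If `s` lifts `1` and `τ_E(τ^*s) = s + m`, a sequence of approximate solutions `ξ_n` of
`ξ = τ_M(τ^*ξ) + m` that are fixed by `I` gives the element `e = lim (ξ_n + s)` of `T_ℓ E`. It
lifts `1` and is fixed by `I`, so the extension of `I`-modules splits. -/
theorem Extension.splitsOn_of_approximate_solutions {M : AMotive κ} (E : Extension M)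
    {ℓ : Ideal A} {I : Set (L ≃ₐ[F] L)} {m : jInv κ M.carrier} {s : E.obj.carrier}
    (hs : E.proj.toLinearMap s = (1 : A ⊗[𝔽] F))
    (hs' : E.obj.phi s = jInvMap κ E.inj.toLinearMap m + toJInv κ _ s)
    {ξ : ℕ → BaseChange 𝔽 A F L M.carrier}
    (hξ : ∀ n, ξ (n + 1) - ξ n ∈ ℓ ^ n • (⊤ : Submodule A (BaseChange 𝔽 A F L M.carrier)))
    (hξ' : ∀ n, baseChangeMap L (toJInv κ M.carrier) (ξ n) - M.phiBaseChange L (ξ n) -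
      1 ⊗ₜ[A ⊗[𝔽] F] m ∈ ℓ ^ n • (⊤ : Submodule A (BaseChange 𝔽 A F L (jInv κ M.carrier))))
    (hI : ∀ σ ∈ I, ∀ n, galoisMap σ M.carrier (ξ n) = ξ n) : E.SplitsOn ℓ I := by
  let e : ℕ → BaseChange 𝔽 A F L E.obj.carrier := fun n =>
    baseChangeMap L E.inj.toLinearMap (ξ n) + (1 : A ⊗[𝔽] L) ⊗ₜ[A ⊗[𝔽] F] s
  have he : ∀ n, e n ≡ e (n + 1)
      [SMOD ℓ ^ n • (⊤ : Submodule A (BaseChange 𝔽 A F L E.obj.carrier))] := fun n => by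
    refine (SModEq.sub_mem.2 ?_).symm
    have := map_mem_smul_top (ℓ ^ n) (baseChangeMap L E.inj.toLinearMap) (hξ n)
    rw [map_sub] at this
    rwa [add_sub_add_right_eq_sub]
  let e' := AdicCompletion.AdicCauchySequence.mk ℓ _ e he
  have hphi := fun n => E.tate_sub_mem_smul_top hs' (hξ' n)
  refine ⟨AdicCompletion.mk ℓ _ e', ?_, ?_, 0, zero_mem _, fun σ hσ => ?_⟩
  · change AdicCompletion.map ℓ _ _ = AdicCompletion.map ℓ _ _
    rw [AdicCompletion.map_mk, AdicCompletion.map_mk, ← sub_eq_zero, ← map_sub]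
    exact AdicCompletion.mk_zero_of _ _ _ ⟨0, fun n _ => ⟨n, le_rfl, n, le_rfl, hphi n⟩⟩
  · refine AdicCompletion.ext fun n => congrArg (Submodule.Quotient.mk) ?_
    change baseChangeMap L E.proj.toLinearMap (e n) =
      (1 : A ⊗[𝔽] L) ⊗ₜ[A ⊗[𝔽] F] (1 : A ⊗[𝔽] F)
    have h0 : E.proj.toLinearMap ∘ₗ E.inj.toLinearMap = 0 :=
      LinearMap.ext fun x => E.exact.apply_apply_eq_zero x
    rw [map_add, baseChangeMap_comp_apply, h0, baseChangeMap_zero_apply, zero_add,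
      baseChangeMap_one_tmul, hs]
    rfl
  · rw [map_zero, sub_zero, map_zero, sub_eq_zero]
    refine AdicCompletion.ext fun n => congrArg (Submodule.Quotient.mk) ?_
    change galoisMap σ E.obj.carrier (e n) = e n
    rw [map_add, galoisMap_baseChangeMap, hI σ hσ, galoisMap_one_tmul]

end Splitting

end AndersonMotive

open AndersonMotive in
theorem theoremC
    -- the finite field `𝔽` and the coefficient ring `A = Γ(C ∖ {∞}, 𝒪_C)`
    (𝔽 A : Type u) [Field 𝔽] [Fintype 𝔽] [CommRing A] [Algebra 𝔽 A]
    (hA : AndersonMotive.IsCurveCoordinateRing 𝔽 A)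
    -- the local function field `F` with its valuation ring `O`
    (O F : Type u) [CommRing O] [IsDomain O] [IsDiscreteValuationRing O]
    [IsAdicComplete (IsLocalRing.maximalIdeal O) O] [Finite (IsLocalRing.ResidueField O)]
    [Field F] [Algebra O F] [IsFractionRing O F]
    [Algebra 𝔽 O] [Algebra 𝔽 F] [IsScalarTower 𝔽 O F]
    -- a separable closure `Fs` of `F`
    (Fs : Type u) [Field Fs] [Algebra F Fs] [IsSepClosure F Fs]
    [Algebra 𝔽 Fs] [IsScalarTower 𝔽 F Fs] [Algebra O Fs] [IsScalarTower O F Fs]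
    -- the characteristic morphism `κ : A → O` and an `A`-motive `M` over `F`
    (κ : A →ₐ[𝔽] O)
    (M : AndersonMotive.AMotive ((IsScalarTower.toAlgHom 𝔽 O F).comp κ))
    -- the maximal ideal `ℓ` of `A`
    (ℓ : Ideal A) (hℓ : ℓ.IsMaximal) (hκ : ℓ.map κ = ⊤) :
    AndersonMotive.integralPart O M ⊆ AndersonMotive.goodPart O Fs M ℓ := by
  have : IsScalarTower 𝔽 O Fs := IsScalarTower.of_algebraMap_eq fun x => by
    rw [IsScalarTower.algebraMap_apply O F Fs, ← IsScalarTower.algebraMap_apply 𝔽 O F,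
      ← IsScalarTower.algebraMap_apply 𝔽 F Fs]
  have := hA.finiteType
  have : Module.Finite 𝔽 (A ⧸ ℓ) := by
    let _ := Ideal.Quotient.field ℓ
    exact finite_of_finite_type_of_isJacobsonRing 𝔽 (A ⧸ ℓ)
  -- As `O` is local, some element of `ℓ` has an invertible image; it is not a constant.
  obtain ⟨a, ha, hκa⟩ : ∃ a ∈ ℓ, IsUnit (κ a) := by
    by_contra! h
    refine (IsLocalRing.maximalIdeal.isMaximal O).ne_top (top_le_iff.1 (hκ.ge.trans ?_))
    exact Ideal.map_le_iff_le_comap.2 fun a ha => h a ha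
  have ha' : a ∉ Set.range (algebraMap 𝔽 A) := by
    rintro ⟨c, rfl⟩
    rcases eq_or_ne c 0 with rfl | hc
    · exact not_isUnit_zero (M₀ := O) (by rwa [map_zero, map_zero] at hκa)
    · exact hℓ.ne_top (Ideal.eq_top_of_isUnit_mem _ ha (hc.isUnit.map (algebraMap 𝔽 A)))
  rintro _ ⟨m, hm, rfl⟩ E hE
  obtain ⟨s, hs, hs'⟩ := Extension.exists_section_of_mk_eq_iota hE.symm
  obtain ⟨ξ, hξ, hξ', hσ⟩ := exists_approximate_solutions_of_subJInv (L := Fs)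
    (U := unramifiedIntegers O F Fs) rfl M
    (exists_unramifiedIntegers_eval_eq_self O F Fs) ha hκa ha' hm
  exact E.splitsOn_of_approximate_solutions hs hs' hξ hξ'
    fun σ hσI => hσ σ fun x => x.2.2 σ hσI
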